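/- Let $K\le L$ be nonnegative integers and $\mathcal D=[L]$ a set of items. For steps $t=1,\dots,n$ let $\alpha_t\in[0,1]^L$, and let the attraction indicators $A_t(a)$ ($1\le t\le n$, $a\in\mathcal D$) be mutually independent Bernoulli variables with means $\alpha_t(a)$. Let $\Upsilon_n=\#\{2\le t\le n:\alpha_t\ne\alpha_{t-1}\}$ be the number of breakpoints. At step $t$ an agent shows a ranked list $R_t$ of $K$ distinct items, and the user clicks on the first attractive item; the agent observes only the click position $c_t=\min(\{i\le K: A_t(R_t(i))=1\}\cup\{K+1\})$. Put $r(R,w)=1-\prod_{i=1}^K(1-w(R(i)))$. The expected regret is $R(n)=\sum_{t=1}^n\mathbb E[\max_R r(R,\alpha_t)-r(R_t,A_t)]$. CascadeDUCB with parameters $\varepsilon,\gamma$ keeps statistics $N(a),X(a)$, initially $0$. At step $t$ it computes $$U_t(a)=\frac{X(a)}{N(a)}+2\sqrt{\frac{\varepsilon\ln N_t(\gamma)}{N(a)}},\qquad N_t(\gamma)=\frac{1-\gamma^t}{1-\gamma},$$ from the statistics of the first $t-1$ steps, with the convention $x/0:=1$. It shows $K$ items with the largest values of $U_t$ (ties,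 and the order within the list, are resolved by an arbitrary rule depending on the history). It then multiplies all $N(a),X(a)$ by $\gamma$, adds $1$ to $N(R_t(i))$ for each $i\le\min\{c_t,K\}$, and adds $1$ to $X(R_t(c_t))$ if $c_t\le K$. For every $t\le n$ let $\mathcal D_t^*$ be a set of $K$ most attractive items (those with largest $\alpha_t$), and let $\Delta_{a,K}=\min\{\alpha_t(a^*)-\alpha_t(a): t\in[n],\ a\notin\mathcal D_t^*,\ a^*\in\mathcal D_t^*\}\in[0,\infty]$ (the minimum is $\infty$ when there is no such $t$ or $a^*$; $1/\infty=0$, $1/0=\infty$, $0\cdot\infty=0$). **Theorem.** Let $\varepsilon\in(1/2,1)$. (i) For every $\gamma\in(1/2,1)$, the expected $n$-step regret of CascadeDUCB satisfies $$R(n)\le L\,\Upsilon_n\frac{\ln[(1-\gamma)\varepsilon]}{\ln\gamma}+\sum_{a\in\mathcal D}C(\gamma,a)\,\lceil n(1-\gamma)\rceil\,\ln\frac1{1-\gamma},$$ where $$C(\gamma,a)=\frac{4}{1-1/e}\ln\!\Big(1+4\sqrt{1-\tfrac1{2\varepsilon}}\Big)+\frac{32\,\varepsilon}{\Delta_{a,K}\,\gamma^{1/(1-\gamma)}}.$$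 (ii) If $\Upsilon_n\ge1$ and $\gamma=1-\frac14\sqrt{\Upsilon_n/n}$, then $R(n)=O(\sqrt{n\Upsilon_n}\,\ln n)$: for every $\delta>0$ there is a constant $c$ depending only on $L,K,\varepsilon,\delta$ such that $R(n)\le c\sqrt{n\Upsilon_n}\ln n$ for every $n$ and every such environment with $\Upsilon_n\ge 1$ and $\Delta_{a,K}\ge\delta$ for all $a$. -/

import Mathlib

open MeasureTheory ProbabilityTheory
open scoped ENNReal

universe u

noncomputable section

namespace CascadeBandit

/-- A ranked list of `K` distinct items from `Fin L`; position `i : Fin K` is the `(i+1)`-st. -/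
abbrev RankedList (L K : ℕ) : Type := Fin K ↪ Fin L

/-- `S` consists of `K` items with the largest values of `u` (ties broken in any way). -/
def IsTopK {L : ℕ} (K : ℕ) (u : Fin L → ℝ) (S : Finset (Fin L)) : Prop :=
  S.card = K ∧ ∀ a ∈ S, ∀ b ∉ S, u b ≤ u a

/-- The reward `r(R, w) = 1 - ∏ i, (1 - w (R i))`. -/
def reward {L K : ℕ} (R : RankedList L K) (w : Fin L → ℝ) : ℝ :=
  1 - ∏ i, (1 - w (R i))

/-- Attraction indicators as a `0/1` valued vector. -/
def toReal {L : ℕ} (A : Fin L → Bool) (a : Fin L) : ℝ := if A a = true then 1 else 0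

/-- The click in the cascade model: the (1-based) position of the first attractive item of the
list, and `K + 1` if no item of the list is attractive. -/
def click {L K : ℕ} (R : RankedList L K) (A : Fin L → Bool) : ℕ :=
  sInf ({j : ℕ | ∃ i : Fin K, i.val + 1 = j ∧ A (R i) = true} ∪ {K + 1})

/-- What the agent has seen so far, most recent step first: displayed lists with the
(1-based) click positions. -/
abbrev History (L K : ℕ) : Type := List (RankedList L K × ℕ)

open Classical in
/-- Discounted number of times that an item was examined (shown at a position `≤` the click). -/
def discN {L K : ℕ} (γ : ℝ) : History L K → Fin L → ℝ
  | [], _ => 0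
  | (R, c) :: h, a => γ * discN γ h a + if ∃ i : Fin K, R i = a ∧ i.val + 1 ≤ c then 1 else 0

open Classical in
/-- Discounted number of times that an item was clicked. -/
def discX {L K : ℕ} (γ : ℝ) : History L K → Fin L → ℝ
  | [], _ => 0
  | (R, c) :: h, a => γ * discX γ h a + if ∃ i : Fin K, R i = a ∧ i.val + 1 = c then 1 else 0

/-- The discounted time horizon `N_t(γ)`. -/
def horizon (γ : ℝ) (t : ℕ) : ℝ := (1 - γ ^ t) / (1 - γ)

open Classical in
/-- Division with the convention `x / 0 = 1`. -/
def divOne (x y : ℝ) : ℝ := if y = 0 then 1 else x / y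

/-- The upper confidence bound of an item at step `t = h.length + 1`, given the history `h` of the
first `t - 1` steps: discounted click rate plus confidence radius. -/
def ucb {L K : ℕ} (γ ε : ℝ) (h : History L K) (a : Fin L) : ℝ :=
  divOne (discX γ h a) (discN γ h a) +
    2 * √(divOne (ε * Real.log (horizon γ (h.length + 1))) (discN γ h a))

/-- A policy maps the history to the next list. It is a CascadeDUCB policy if the list always
consists of `K` items with the largest upper confidence bounds; ties, and the order within the
list, may be resolved in any way depending on the history. -/
def IsCascadeDUCB {L K : ℕ} (γ ε : ℝ) (π : History L K → RankedList L K) : Prop :=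
  ∀ h : History L K, IsTopK K (ucb γ ε h) (Finset.univ.map (π h))

/-- The history after `t` steps when the attraction indicators at steps `1, 2, …` are
`A 1, A 2, …`. -/
def hist {L K : ℕ} (π : History L K → RankedList L K) (A : ℕ → Fin L → Bool) : ℕ → History L K
  | 0 => []
  | t + 1 => (π (hist π A t), click (π (hist π A t)) (A (t + 1))) :: hist π A t

/-- The list displayed at step `t ≥ 1`. -/
def shown {L K : ℕ} (π : History L K → RankedList L K) (A : ℕ → Fin L → Bool) (t : ℕ) :
    RankedList L K :=
  π (hist π A (t - 1))

/-- The attraction indicators `A t · a`, for steps `1 ≤ t ≤ n` and items `a`, are mutually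
independent Bernoulli variables with means `α t a`. -/
structure IsEnvironment {Ω : Type u} [MeasurableSpace Ω] (μ : Measure Ω) {L : ℕ} (n : ℕ)
    (α : ℕ → Fin L → ℝ) (A : ℕ → Ω → Fin L → Bool) : Prop where
  measurable : ∀ t ∈ Finset.Icc 1 n, ∀ a, Measurable fun ω => A t ω a
  law : ∀ t ∈ Finset.Icc 1 n, ∀ a, μ.real {ω | A t ω a = true} = α t a
  indep : iIndepFun (fun (p : ↥(Finset.Icc 1 n) × Fin L) (ω : Ω) => A p.1 ω p.2) μ

open Classical in
/-- The number of breakpoints: steps `2 ≤ t ≤ n` at which the attraction probabilities change. -/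
def numBreaks {L : ℕ} (α : ℕ → Fin L → ℝ) (n : ℕ) : ℕ :=
  ((Finset.Icc 2 n).filter fun t => α t ≠ α (t - 1)).card

/-- The expected `n`-step regret of a policy. -/
def regret {Ω : Type u} [MeasurableSpace Ω] (μ : Measure Ω) {L K : ℕ} (α : ℕ → Fin L → ℝ)
    (A : ℕ → Ω → Fin L → Bool) (π : History L K → RankedList L K) (n : ℕ) : ℝ :=
  ∑ t ∈ Finset.Icc 1 n,
    ∫ ω, ((⨆ R : RankedList L K, reward R (α t)) -
      reward (shown π (fun s => A s ω) t) (toReal (A t ω))) ∂μ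

/-- The gap `Δ_{a,K}`: the smallest difference between the attraction probabilities of an optimal
item and of `a`, over all steps `1 ≤ t ≤ n` at which `a` is not among the `K` optimal items
`D t`. It is `∞` for an item that is optimal at all steps. -/
def gap {L : ℕ} (α : ℕ → Fin L → ℝ) (D : ℕ → Finset (Fin L)) (n : ℕ) (a : Fin L) : ℝ≥0∞ :=
  ⨅ t ∈ Finset.Icc 1 n, ⨅ (_ : a ∉ D t), ⨅ b ∈ D t, ENNReal.ofReal (α t b - α t a)

/-- The constant `C(γ, a)` for an item with gap `Δ`; `1 / 0 = ∞` and `1 / ∞ = 0`. -/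
def constC (ε γ : ℝ) (Δ : ℝ≥0∞) : ℝ≥0∞ :=
  ENNReal.ofReal (4 / (1 - 1 / Real.exp 1) * Real.log (1 + 4 * √(1 - 1 / (2 * ε)))) +
    ENNReal.ofReal (32 * ε) / (Δ * ENNReal.ofReal (γ ^ (1 / (1 - γ))))

end CascadeBandit

end

/-!
For a fixed item, the centred discounted click count gives an exponential supermartingale for each
tilt (Hoeffding's lemma at each step). Markov's inequality and a union bound over a geometric grid
of tilts show that a confidence radius fails with probability `O(1 / N_t(γ))` once the attraction
probabilities have been constant for `2 log ((1 - γ) ε) / log γ` steps; a step closer than that to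
the last breakpoint costs at most `1`, which the factor `L ≥ 2` of the first term pays for.

While the radii hold, a shown suboptimal item of gap `g` and discounted count `N` satisfies
`g ^ 2 * N ≤ 16 ε log (1 / (1 - γ))`. Matching the shown suboptimal items with the optimal items
they displace bounds the loss of a step by the expected number of examinations of suboptimal items,
each weighted by its gap. Over a block of `1 / (1 - γ)` steps discounting loses at most the factor
`γ ^ (1 / (1 - γ))`, so the weighted examinations of one item sum to at most
`32 ε log (1 / (1 - γ)) / (Δ γ ^ (1 / (1 - γ)))` per block, with enough room left to absorb the
cost of the radius failures. This needs `γ` close to `1`; for `γ < 99 / 100` the second term of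
the bound already exceeds `n`. The tuned bound follows from `γ ^ (1 / (1 - γ)) ≥ exp (-2)`, valid
for `γ ≥ 1 / 2`.
-/

namespace CascadeBandit

section BernoulliExpectation

variable {ι κ : Type*} [Fintype ι]

/-- The probability of the outcome `v` for independent Bernoulli variables with means `p`. -/
noncomputable def bernWeight (p : ι → ℝ) (v : ι → Bool) : ℝ :=
  ∏ a, if v a = true then p a else 1 - p a

theorem bernWeight_nonneg {p : ι → ℝ} (hp : ∀ a, p a ∈ Set.Icc 0 1) (v : ι → Bool) :
    0 ≤ bernWeight p v := by
  refine Finset.prod_nonneg fun a _ => ?_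
  split_ifs
  · exact (hp a).1
  · exact sub_nonneg.2 (hp a).2

variable [DecidableEq ι]

/-- The expectation of `f` for independent Bernoulli variables with means `p`. It is a finite sum,
so that the computations for a single step need no integrability conditions. -/
noncomputable def bernExp (p : ι → ℝ) (f : (ι → Bool) → ℝ) : ℝ :=
  ∑ v, bernWeight p v * f v

theorem bernExp_mono {p : ι → ℝ} (hp : ∀ a, p a ∈ Set.Icc 0 1) {f g : (ι → Bool) → ℝ}
    (hfg : ∀ v, f v ≤ g v) : bernExp p f ≤ bernExp p g :=
  Finset.sum_le_sum fun v _ => mul_le_mul_of_nonneg_left (hfg v) (bernWeight_nonneg hp v)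

theorem bernExp_add (p : ι → ℝ) (f g : (ι → Bool) → ℝ) :
    bernExp p (fun v => f v + g v) = bernExp p f + bernExp p g := by
  simp only [bernExp, mul_add, Finset.sum_add_distrib]

theorem bernExp_const_mul (p : ι → ℝ) (c : ℝ) (f : (ι → Bool) → ℝ) :
    bernExp p (fun v => c * f v) = c * bernExp p f := by
  simp only [bernExp, Finset.mul_sum, mul_left_comm]

theorem bernExp_sum (p : ι → ℝ) (s : Finset κ) (f : κ → (ι → Bool) → ℝ) :
    bernExp p (fun v => ∑ k ∈ s, f k v) = ∑ k ∈ s, bernExp p (f k) := by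
  simp only [bernExp, Finset.mul_sum]
  exact Finset.sum_comm

theorem bernExp_prod (p : ι → ℝ) (f : ι → Bool → ℝ) :
    bernExp p (fun v => ∏ a, f a (v a)) = ∏ a, (p a * f a true + (1 - p a) * f a false) := by
  have h : ∀ a, p a * f a true + (1 - p a) * f a false =
      ∑ b : Bool, (if b = true then p a else 1 - p a) * f a b := fun a => by simp
  simp_rw [h, Finset.prod_univ_sum, Fintype.piFinset_univ, bernExp, bernWeight,
    Finset.prod_mul_distrib]

theorem bernExp_const (p : ι → ℝ) (c : ℝ) : bernExp p (fun _ => c) = c := by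
  have h1 : bernExp p (fun _ => 1) = 1 := by simpa using bernExp_prod p fun _ _ => 1
  simpa [h1] using bernExp_const_mul p c fun _ => 1

theorem bernExp_prod_comp {e : κ → ι} (he : Function.Injective e) (s : Finset κ) (p : ι → ℝ)
    (f : κ → Bool → ℝ) :
    bernExp p (fun v => ∏ k ∈ s, f k (v (e k))) =
      ∏ k ∈ s, (p (e k) * f k true + (1 - p (e k)) * f k false) := by
  classical
  have hfiber : ∀ v : ι → Bool, ∏ k ∈ s, f k (v (e k)) =
      ∏ a, ∏ k ∈ s with e k = a, f k (v a) := fun v => by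
    rw [← Finset.prod_fiberwise s e]
    refine Finset.prod_congr rfl fun a _ => Finset.prod_congr rfl fun k hk => ?_
    rw [(Finset.mem_filter.1 hk).2]
  simp_rw [hfiber]
  rw [bernExp_prod p fun a b => ∏ k ∈ s with e k = a, f k b, ← Finset.prod_fiberwise s e]
  refine Finset.prod_congr rfl fun a _ => ?_
  have hcard : (s.filter fun k => e k = a).card ≤ 1 := Finset.card_le_one.2 fun j hj k hk =>
    he ((Finset.mem_filter.1 hj).2.trans (Finset.mem_filter.1 hk).2.symm)
  rcases Nat.le_one_iff_eq_zero_or_eq_one.1 hcard with h0 | h1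
  · simp [Finset.card_eq_zero.1 h0]
  · obtain ⟨k, hk⟩ := Finset.card_eq_one.1 h1
    have hek : e k = a := (Finset.mem_filter.1 (hk.ge (Finset.mem_singleton_self k))).2
    simp only [hk, Finset.prod_singleton, hek]

theorem bernoulli_mgf_le {p : ℝ} (hp : p ∈ Set.Icc 0 1) (t : ℝ) :
    p * Real.exp (t * (1 - p)) + (1 - p) * Real.exp (t * (0 - p)) ≤ Real.exp (t ^ 2 / 8) := by
  have hsupp : ∀ᵐ x ∂Ber((1 : ℝ), 0, ⟨p, hp⟩), id x ∈ Set.Icc 0 1 :=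
    bernoulliMeasure_apply_of_notMem_of_notMem _ measurableSet_Icc.compl (by simp) (by simp)
  have h := (hasSubgaussianMGF_of_mem_Icc aemeasurable_id hsupp).mgf_le t
  simp only [mgf, integral_bernoulliMeasure, id, smul_eq_mul] at h
  convert h using 2 <;> norm_num
  ring

end BernoulliExpectation

section Clicks

variable {L K : ℕ}

theorem le_click_iff (R : RankedList L K) (v : Fin L → Bool) (i : Fin K) :
    i.val + 1 ≤ click R v ↔ ∀ j < i, v (R j) = false := by
  rw [click, le_csInf_iff'' ⟨K + 1, Or.inr rfl⟩]
  constructor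
  · intro h j hji
    by_contra hj
    have hij := h (j.val + 1) (Or.inl ⟨j, rfl, by simpa using hj⟩)
    have := Fin.lt_def.1 hji
    omega
  · rintro h b (⟨j, rfl, hj⟩ | rfl)
    · by_contra hlt
      simp [h j (by rw [Fin.lt_def]; omega)] at hj
    · have := i.2
      omega

theorem eq_click_iff (R : RankedList L K) (v : Fin L → Bool) (i : Fin K) :
    i.val + 1 = click R v ↔ (∀ j < i, v (R j) = false) ∧ v (R i) = true := by
  constructor
  · intro h
    refine ⟨(le_click_iff R v i).1 h.le, ?_⟩
    have hmem : click R v ∈ ({j | ∃ i : Fin K, i.val + 1 = j ∧ v (R i) = true} ∪ {K + 1} : Set ℕ) :=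
      Nat.sInf_mem ⟨K + 1, Or.inr rfl⟩
    rcases hmem with ⟨j, hj, hv⟩ | hb
    · rwa [← (Fin.ext (by omega) : j = i)]
    · have := i.2
      have : click R v = K + 1 := hb
      omega
  · rintro ⟨hbefore, hi⟩
    exact ((le_click_iff R v i).2 hbefore).antisymm (Nat.sInf_le (Or.inl ⟨i, rfl, hi⟩))

open Classical in
/-- The indicator that item `a` of the list `R` is examined when the click is at position `c`: the
increment of `discN`. -/
noncomputable def examInd (R : RankedList L K) (c : ℕ) (a : Fin L) : ℝ :=
  if ∃ i : Fin K, R i = a ∧ i.val + 1 ≤ c then 1 else 0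

open Classical in
/-- The indicator that item `a` of the list `R` is clicked when the click is at position `c`: the
increment of `discX`. -/
noncomputable def clickInd (R : RankedList L K) (c : ℕ) (a : Fin L) : ℝ :=
  if ∃ i : Fin K, R i = a ∧ i.val + 1 = c then 1 else 0

theorem examInd_eq_zero_or_one (R : RankedList L K) (c : ℕ) (a : Fin L) :
    examInd R c a = 0 ∨ examInd R c a = 1 := by
  unfold examInd; split_ifs <;> simp

theorem examInd_nonneg (R : RankedList L K) (c : ℕ) (a : Fin L) : 0 ≤ examInd R c a := by
  rcases examInd_eq_zero_or_one R c a with h | h <;> simp [h]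

theorem examInd_le_one (R : RankedList L K) (c : ℕ) (a : Fin L) : examInd R c a ≤ 1 := by
  rcases examInd_eq_zero_or_one R c a with h | h <;> simp [h]

theorem abs_clickInd_sub_le (R : RankedList L K) (c : ℕ) (a : Fin L) {p : ℝ}
    (hp : p ∈ Set.Icc 0 1) : |clickInd R c a - p * examInd R c a| ≤ examInd R c a := by
  have himp : (∃ i : Fin K, R i = a ∧ i.val + 1 = c) → ∃ i : Fin K, R i = a ∧ i.val + 1 ≤ c :=
    fun ⟨i, hi, hc⟩ => ⟨i, hi, hc.le⟩
  obtain ⟨hp0, hp1⟩ := hp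
  unfold clickInd examInd
  rw [abs_le]
  split_ifs <;> first | (exact absurd (himp ‹_›) ‹_›) | constructor <;> linarith

/-- The probability that position `i` of the list `R` is examined when the items attract
independently with probabilities `p`. -/
def examProb (p : Fin L → ℝ) (R : RankedList L K) (i : Fin K) : ℝ :=
  ∏ j with j < i, (1 - p (R j))

theorem examProb_nonneg {p : Fin L → ℝ} (hp : ∀ a, p a ≤ 1) (R : RankedList L K) (i : Fin K) :
    0 ≤ examProb p R i :=
  Finset.prod_nonneg fun j _ => sub_nonneg.2 (hp (R j))

theorem examProb_le_one {p : Fin L → ℝ} (hp : ∀ a, p a ∈ Set.Icc 0 1) (R : RankedList L K)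
    (i : Fin K) : examProb p R i ≤ 1 :=
  Finset.prod_le_one (fun j _ => sub_nonneg.2 (hp (R j)).2) fun j _ => sub_le_self 1 (hp (R j)).1

theorem exists_position_iff (R : RankedList L K) (P : ℕ → Prop) (i : Fin K) :
    (∃ j : Fin K, R j = R i ∧ P j.val) ↔ P i.val :=
  ⟨fun ⟨_, hj, h⟩ => R.injective hj ▸ h, fun h => ⟨i, rfl, h⟩⟩

theorem examInd_click (R : RankedList L K) (v : Fin L → Bool) (i : Fin K) :
    examInd R (click R v) (R i) = examProb (toReal v) R i := by
  rw [examInd, examProb, if_congr (exists_position_iff R (fun k => k + 1 ≤ click R v) i) rfl rfl,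
    if_congr (le_click_iff R v i) rfl rfl]
  split_ifs with h
  · exact (Finset.prod_eq_one fun j hj => by simp [toReal, h j (by simpa using hj)]).symm
  · push Not at h
    obtain ⟨j, hj, hv⟩ := h
    exact (Finset.prod_eq_zero (i := j) (by simpa using hj) (by simp [toReal, hv])).symm

theorem clickInd_click (R : RankedList L K) (v : Fin L → Bool) (i : Fin K) :
    clickInd R (click R v) (R i) = examInd R (click R v) (R i) * toReal v (R i) := by
  unfold clickInd examInd toReal
  rw [if_congr (exists_position_iff R (fun k => k + 1 ≤ click R v) i) rfl rfl,
    if_congr (exists_position_iff R (fun k => k + 1 = click R v) i) rfl rfl,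
    if_congr (le_click_iff R v i) rfl rfl, if_congr (eq_click_iff R v i) rfl rfl]
  split_ifs <;> simp_all

theorem bernExp_examInd_mul (p : Fin L → ℝ) (R : RankedList L K) (i : Fin K) (g : Bool → ℝ) :
    bernExp p (fun v => examInd R (click R v) (R i) * g (v (R i))) =
      examProb p R i * (p (R i) * g true + (1 - p (R i)) * g false) := by
  let s : Finset (Fin K) := Finset.univ.filter (· < i)
  have hi : i ∉ s := by simp [s]
  let f : Fin K → Bool → ℝ := Function.update (fun _ b => if b = true then 0 else 1) i g
  have hfi : f i = g := Function.update_self ..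
  have hf : ∀ j ∈ s, f j = fun b => if b = true then 0 else 1 := fun j hj =>
    Function.update_of_ne (Finset.mem_filter.1 hj).2.ne ..
  calc bernExp p (fun v => examInd R (click R v) (R i) * g (v (R i)))
      = bernExp p fun v => ∏ j ∈ insert i s, f j (v (R j)) := by
        congr with v
        rw [examInd_click, examProb, Finset.prod_insert hi, hfi, mul_comm]
        congr 1
        refine Finset.prod_congr rfl fun j hj => ?_
        cases h : v (R j) <;> simp [hf j hj, toReal, h]
    _ = ∏ j ∈ insert i s, (p (R j) * f j true + (1 - p (R j)) * f j false) :=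
        bernExp_prod_comp R.injective _ p f
    _ = _ := by
        rw [examProb, Finset.prod_insert hi, hfi, mul_comm]
        congr 1
        exact Finset.prod_congr rfl fun j hj => by simp [hf j hj]

theorem bernExp_examInd (p : Fin L → ℝ) (R : RankedList L K) (i : Fin K) :
    bernExp p (fun v => examInd R (click R v) (R i)) = examProb p R i := by
  simpa using bernExp_examInd_mul p R i fun _ => 1

theorem bernExp_reward (p : Fin L → ℝ) (R : RankedList L K) :
    bernExp p (fun v => reward R (toReal v)) = reward R p := by
  have hprod : bernExp p (fun v => ∏ i, (1 - toReal v (R i))) = ∏ i, (1 - p (R i)) :=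
    (bernExp_prod_comp R.injective Finset.univ p fun _ b => 1 - if b = true then 1 else 0).trans
      (Finset.prod_congr rfl fun i _ => by simp)
  have h := bernExp_add p (fun v => reward R (toReal v)) fun v => ∏ i, (1 - toReal v (R i))
  simp only [hprod, reward, sub_add_cancel, bernExp_const] at h
  simp only [reward]
  linarith

theorem bernExp_exp_le_one {p : Fin L → ℝ} (hp : ∀ a, p a ∈ Set.Icc 0 1) (R : RankedList L K)
    (a : Fin L) (t : ℝ) :
    bernExp p (fun v => Real.exp (t * (clickInd R (click R v) a - p a * examInd R (click R v) a)
      - t ^ 2 / 8 * examInd R (click R v) a)) ≤ 1 := by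
  by_cases ha : ∃ i, R i = a
  · obtain ⟨i, rfl⟩ := ha
    let g : Bool → ℝ := fun b =>
      Real.exp (t * ((if b = true then 1 else 0) - p (R i)) - t ^ 2 / 8) - 1
    have hexp : ∀ v, Real.exp (t * (clickInd R (click R v) (R i) -
        p (R i) * examInd R (click R v) (R i)) - t ^ 2 / 8 * examInd R (click R v) (R i)) =
        1 + examInd R (click R v) (R i) * g (v (R i)) := fun v => by
      rw [clickInd_click]
      rcases examInd_eq_zero_or_one R (click R v) (R i) with h | h <;> simp [h, g, toReal]
    have hhoeffding : p (R i) * g true + (1 - p (R i)) * g false ≤ 0 := by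
      have h := mul_le_mul_of_nonneg_right (bernoulli_mgf_le (hp (R i)) t)
        (Real.exp_pos (-(t ^ 2 / 8))).le
      rw [← Real.exp_add, add_neg_cancel, Real.exp_zero, add_mul, mul_assoc, mul_assoc,
        ← Real.exp_add, ← Real.exp_add] at h
      simp only [g, sub_eq_add_neg] at h ⊢
      simp only [if_true, Bool.false_eq_true, if_false]
      linarith
    simp_rw [hexp]
    rw [bernExp_add, bernExp_const, bernExp_examInd_mul]
    linarith [mul_nonpos_of_nonneg_of_nonpos (examProb_nonneg (fun a => (hp a).2) R i)
      hhoeffding]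
  · push Not at ha
    simp [examInd, clickInd, ha, bernExp_const]

end Clicks

section Environment

variable {L K : ℕ}

theorem dependsOn_hist (π : History L K → RankedList L K) (t : ℕ) :
    DependsOn (fun B : ℕ → Fin L → Bool => hist π B t) (Set.Icc 1 t) := by
  intro B B' h
  induction t with
  | zero => rfl
  | succ t ih =>
    have hprev := ih fun s hs => h s ⟨hs.1, hs.2.trans t.le_succ⟩
    simp only at hprev
    simp only [hist, hprev, h (t + 1) ⟨t.succ_pos, le_rfl⟩]

theorem length_hist (π : History L K → RankedList L K) (B : ℕ → Fin L → Bool) (t : ℕ) :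
    (hist π B t).length = t := by
  induction t with
  | zero => rfl
  | succ t ih => rw [hist, List.length_cons, ih]

variable {Ω : Type u} [MeasurableSpace Ω] {μ : Measure Ω}

theorem integral_comp_of_indepFun [IsProbabilityMeasure μ] {β δ : Type*} [Fintype β]
    [MeasurableSpace β] [MeasurableSingletonClass β] [Finite δ] [MeasurableSpace δ]
    [MeasurableSingletonClass δ] {X : Ω → β} {Y : Ω → δ} (hX : Measurable X) (hY : Measurable Y)
    (hXY : IndepFun X Y μ) (G : δ → β → ℝ) :
    ∫ ω, G (Y ω) (X ω) ∂μ = ∫ ω, ∑ v, μ.real (X ⁻¹' {v}) * G (Y ω) v ∂μ := by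
  have := Measure.isProbabilityMeasure_map (μ := μ) hX.aemeasurable
  have := Measure.isProbabilityMeasure_map (μ := μ) hY.aemeasurable
  have hprod := (indepFun_iff_map_prod_eq_prod_map_map hY.aemeasurable hX.aemeasurable).1 hXY.symm
  calc ∫ ω, G (Y ω) (X ω) ∂μ
      = ∫ z, G z.1 z.2 ∂μ.map (fun ω => (Y ω, X ω)) :=
        (integral_map (f := fun z : δ × β => G z.1 z.2) (hY.prodMk hX).aemeasurable
          (measurable_of_countable _).aestronglyMeasurable).symm
    _ = ∫ y, ∫ v, G y v ∂μ.map X ∂μ.map Y := by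
        rw [hprod, integral_prod _ .of_finite]
    _ = ∫ ω, ∫ v, G (Y ω) v ∂μ.map X ∂μ :=
        integral_map (f := fun y => ∫ v, G y v ∂μ.map X) hY.aemeasurable
          (measurable_of_countable _).aestronglyMeasurable
    _ = _ := by
        congr with ω
        rw [integral_fintype .of_finite]
        exact Finset.sum_congr rfl fun v _ => by
          rw [map_measureReal_apply hX (measurableSet_singleton v), smul_eq_mul]

variable {n : ℕ} {A : ℕ → Ω → Fin L → Bool} {α : ℕ → Fin L → ℝ}

theorem IsEnvironment.measurable_apply (hA : IsEnvironment μ n α A) {t : ℕ}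
    (ht : t ∈ Finset.Icc 1 n) : Measurable (A t) :=
  measurable_pi_lambda _ fun a => hA.measurable t ht a

theorem IsEnvironment.measurable_domRestrict (hA : IsEnvironment μ n α A) {t : ℕ} (ht : t ≤ n) :
    Measurable fun ω => (Set.Icc 1 t).domRestrict (A · ω) :=
  measurable_pi_lambda _ fun s =>
    hA.measurable_apply (Finset.mem_Icc.2 ⟨s.2.1, s.2.2.trans ht⟩)

theorem IsEnvironment.integrable_of_dependsOn [IsProbabilityMeasure μ]
    (hA : IsEnvironment μ n α A) {F : (ℕ → Fin L → Bool) → ℝ} (hF : DependsOn F (Set.Icc 1 n)) :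
    Integrable (fun ω => F (A · ω)) μ := by
  obtain ⟨g, rfl⟩ := dependsOn_iff_exists_comp.1 hF
  exact Integrable.comp_measurable (g := g) .of_finite (hA.measurable_domRestrict le_rfl)

theorem IsEnvironment.integrable_hist [IsProbabilityMeasure μ] (hA : IsEnvironment μ n α A)
    (π : History L K → RankedList L K) {t : ℕ} (ht : t ≤ n) (F : History L K → ℝ) :
    Integrable (fun ω => F (hist π (A · ω) t)) μ :=
  hA.integrable_of_dependsOn (F := fun B => F (hist π B t)) fun _ _ h =>
    congrArg F (dependsOn_hist π t fun s hs => h s ⟨hs.1, hs.2.trans ht⟩)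

theorem IsEnvironment.mem_Icc [IsProbabilityMeasure μ] (hA : IsEnvironment μ n α A) {t : ℕ}
    (ht : t ∈ Finset.Icc 1 n) (a : Fin L) : α t a ∈ Set.Icc 0 1 := by
  rw [← hA.law t ht a]
  exact ⟨measureReal_nonneg, measureReal_le_one⟩

theorem IsEnvironment.measureReal_preimage_singleton [IsProbabilityMeasure μ]
    (hA : IsEnvironment μ n α A) {t : ℕ} (ht : t ∈ Finset.Icc 1 n) (v : Fin L → Bool) :
    μ.real (A t ⁻¹' {v}) = bernWeight (α t) v := by
  have hrow : iIndepFun (fun (a : Fin L) (ω : Ω) => A t ω a) μ :=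
    hA.indep.precomp (g := fun a => (⟨t, ht⟩, a)) fun _ _ h => (Prod.mk.inj h).2
  have hmarginal : ∀ a, μ.real {ω | A t ω a = v a} = if v a = true then α t a else 1 - α t a := by
    intro a
    split_ifs with hv
    · rw [hv, hA.law t ht a]
    · have hmeas : MeasurableSet {ω | A t ω a = true} :=
        hA.measurable t ht a (measurableSet_singleton true)
      rw [← hA.law t ht a, ← probReal_compl_eq_one_sub hmeas]
      congr 1 with ω
      simp [hv]
  have hinter := hrow.measure_inter_preimage_eq_mul Finset.univ (sets := fun a => {v a})
    fun _ _ => .of_discrete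
  have hpre : A t ⁻¹' {v} = ⋂ a ∈ Finset.univ, (fun ω => A t ω a) ⁻¹' {v a} := by
    ext ω
    simp [funext_iff]
  rw [Measure.real, hpre, hinter, ENNReal.toReal_prod, bernWeight]
  exact Finset.prod_congr rfl fun a _ => hmarginal a

theorem IsEnvironment.indepFun_domRestrict (hA : IsEnvironment μ n α A) {t : ℕ} (ht : t + 1 ≤ n) :
    IndepFun (A (t + 1)) (fun ω => (Set.Icc 1 t).domRestrict (A · ω)) μ := by
  classical
  let S : Finset (↥(Finset.Icc 1 n) × Fin L) := Finset.univ.filter fun p => p.1.1 = t + 1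
  let T : Finset (↥(Finset.Icc 1 n) × Fin L) := Finset.univ.filter fun p => p.1.1 ≤ t
  have hST : Disjoint S T := by
    rw [Finset.disjoint_filter]
    intro p _ h
    omega
  let φ : (S → Bool) → Fin L → Bool := fun u a =>
    u ⟨(⟨t + 1, Finset.mem_Icc.2 ⟨t.succ_pos, ht⟩⟩, a), by simp [S]⟩
  let ψ : (T → Bool) → Set.Icc 1 t → Fin L → Bool := fun u s a =>
    u ⟨(⟨s, Finset.mem_Icc.2 ⟨s.2.1, s.2.2.trans (by omega)⟩⟩, a), by simp [T, s.2.2]⟩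
  exact (hA.indep.indepFun_finset S T hST fun p => hA.measurable _ p.1.2 _).comp (φ := φ) (ψ := ψ)
    (measurable_of_countable _) (measurable_of_countable _)

theorem IsEnvironment.integral_step [IsProbabilityMeasure μ] (hA : IsEnvironment μ n α A)
    (π : History L K → RankedList L K) {t : ℕ} (ht : t + 1 ≤ n)
    (G : History L K → (Fin L → Bool) → ℝ) :
    ∫ ω, G (hist π (A · ω) t) (A (t + 1) ω) ∂μ =
      ∫ ω, bernExp (α (t + 1)) (G (hist π (A · ω) t)) ∂μ := by
  obtain ⟨g, hg⟩ := dependsOn_iff_exists_comp.1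
    fun _ _ h => congrArg G (dependsOn_hist π t h)
  have ht' : t + 1 ∈ Finset.Icc 1 n := Finset.mem_Icc.2 ⟨t.succ_pos, ht⟩
  have hG : ∀ B : ℕ → Fin L → Bool, G (hist π B t) = g ((Set.Icc 1 t).domRestrict B) :=
    fun B => congrFun hg B
  simp_rw [hG, bernExp, ← hA.measureReal_preimage_singleton ht']
  exact integral_comp_of_indepFun (hA.measurable_apply ht')
    (hA.measurable_domRestrict ((Nat.le_succ t).trans ht)) (hA.indepFun_domRestrict ht) g

end Environment

section DiscountedStatistics

variable {L K : ℕ}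

theorem discN_cons (γ : ℝ) (R : RankedList L K) (c : ℕ) (h : History L K) (a : Fin L) :
    discN γ ((R, c) :: h) a = γ * discN γ h a + examInd R c a := rfl

theorem discX_cons (γ : ℝ) (R : RankedList L K) (c : ℕ) (h : History L K) (a : Fin L) :
    discX γ ((R, c) :: h) a = γ * discX γ h a + clickInd R c a := rfl

/-- The discounted sum of the attraction probabilities of an item over the steps at which it was
examined: the compensator of `discX`. -/
noncomputable def discMean (γ : ℝ) (α : ℕ → Fin L → ℝ) : History L K → Fin L → ℝ
  | [], _ => 0
  | (R, c) :: h, a => γ * discMean γ α h a + α (h.length + 1) a * examInd R c a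

variable {γ : ℝ} {α : ℕ → Fin L → ℝ}

theorem discN_nonneg (hγ : 0 ≤ γ) (h : History L K) (a : Fin L) : 0 ≤ discN γ h a := by
  induction h with
  | nil => exact le_rfl
  | cons x h ih =>
    rw [discN_cons]
    exact add_nonneg (mul_nonneg hγ ih) (examInd_nonneg ..)

theorem horizon_succ (hγ : γ ≠ 1) (t : ℕ) : horizon γ (t + 1) = γ * horizon γ t + 1 := by
  have : 1 - γ ≠ 0 := sub_ne_zero.2 hγ.symm
  unfold horizon
  field_simp
  ring

theorem discN_le_horizon (hγ : 0 ≤ γ) (hγ1 : γ ≠ 1) (h : History L K) (a : Fin L) :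
    discN γ h a ≤ horizon γ h.length := by
  induction h with
  | nil => simp [discN, horizon]
  | cons x h ih =>
    rw [discN_cons, List.length_cons, horizon_succ hγ1]
    exact add_le_add (mul_le_mul_of_nonneg_left ih hγ) (examInd_le_one ..)

theorem horizon_le (hγ : 0 ≤ γ) (hγ1 : γ < 1) (t : ℕ) : horizon γ t ≤ 1 / (1 - γ) :=
  div_le_div_of_nonneg_right (sub_le_self 1 (pow_nonneg hγ t)) (sub_nonneg.2 hγ1.le)

theorem abs_discX_sub_discMean_le (hγ : 0 ≤ γ) (h : History L K) (a : Fin L)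
    (hα : ∀ s ∈ Finset.Icc 1 h.length, α s a ∈ Set.Icc 0 1) :
    |discX γ h a - discMean γ α h a| ≤ discN γ h a := by
  induction h with
  | nil => simp [discX, discMean, discN]
  | cons x h ih =>
    obtain ⟨R, c⟩ := x
    have hprev := ih fun s hs => hα s (Finset.Icc_subset_Icc_right (by simp) hs)
    have hlast := abs_clickInd_sub_le R c a (hα (h.length + 1) (by simp))
    rw [discN_cons, discX_cons, discMean]
    calc |γ * discX γ h a + clickInd R c a -
          (γ * discMean γ α h a + α (h.length + 1) a * examInd R c a)|
        = |γ * (discX γ h a - discMean γ α h a) +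
          (clickInd R c a - α (h.length + 1) a * examInd R c a)| := by congr 1; ring
      _ ≤ γ * |discX γ h a - discMean γ α h a| +
          |clickInd R c a - α (h.length + 1) a * examInd R c a| := by
        rw [← abs_of_nonneg hγ, ← abs_mul, abs_of_nonneg hγ]
        exact abs_add_le _ _
      _ ≤ γ * discN γ h a + examInd R c a := by gcongr

theorem abs_discMean_sub_le (hγ : 0 ≤ γ) (h : History L K) (a : Fin L) {p : ℝ}
    (hp : p ∈ Set.Icc 0 1) (hα : ∀ s ∈ Finset.Icc 1 h.length, α s a ∈ Set.Icc 0 1) :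
    |discMean γ α h a - p * discN γ h a| ≤ discN γ h a := by
  induction h with
  | nil => simp [discMean, discN]
  | cons x h ih =>
    obtain ⟨R, c⟩ := x
    have hprev := ih fun s hs => hα s (Finset.Icc_subset_Icc_right (by simp) hs)
    have hlast : |α (h.length + 1) a - p| ≤ 1 := by
      simpa using Set.abs_sub_le_of_uIcc_subset_uIcc
        (Set.uIcc_subset_Icc hp (hα (h.length + 1) (by simp)) |>.trans Set.Icc_subset_uIcc)
    have hexam := examInd_nonneg R c a
    rw [discN_cons, discMean]
    calc |γ * discMean γ α h a + α (h.length + 1) a * examInd R c a -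
          p * (γ * discN γ h a + examInd R c a)|
        = |γ * (discMean γ α h a - p * discN γ h a) +
          (α (h.length + 1) a - p) * examInd R c a| := by congr 1; ring
      _ ≤ γ * |discMean γ α h a - p * discN γ h a| +
          |α (h.length + 1) a - p| * examInd R c a := by
        refine (abs_add_le _ _).trans ?_
        rw [abs_mul, abs_mul, abs_of_nonneg hγ, abs_of_nonneg hexam]
      _ ≤ γ * discN γ h a + 1 * examInd R c a := by gcongr
      _ = γ * discN γ h a + examInd R c a := by rw [one_mul]

theorem abs_discMean_sub_le_pow (hγ : 0 ≤ γ) (hγ1 : γ < 1) (W : ℕ) (h : History L K)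
    (a : Fin L) {p : ℝ} (hp : p ∈ Set.Icc 0 1)
    (hα : ∀ s ∈ Finset.Icc 1 h.length, α s a ∈ Set.Icc 0 1)
    (hrecent : ∀ s ∈ Finset.Icc 1 h.length, h.length < s + W → α s a = p) :
    |discMean γ α h a - p * discN γ h a| ≤ γ ^ W / (1 - γ) := by
  induction W generalizing h with
  | zero =>
    simpa using (abs_discMean_sub_le hγ h a hp hα).trans
      ((discN_le_horizon hγ hγ1.ne h a).trans (horizon_le hγ hγ1 _))
  | succ W ih =>
    cases h with
    | nil =>
      simpa [discMean, discN] using div_nonneg (pow_nonneg hγ _) (sub_nonneg.2 hγ1.le)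
    | cons x h =>
      obtain ⟨R, c⟩ := x
      have hsub : Finset.Icc 1 h.length ⊆ Finset.Icc 1 (h.length + 1) :=
        Finset.Icc_subset_Icc_right (Nat.le_succ _)
      have hprev := ih h (fun s hs => hα s (hsub hs))
        fun s hs hsW => hrecent s (hsub hs) (by rw [List.length_cons]; omega)
      rw [discN_cons, discMean, hrecent (h.length + 1) (by simp) (by simp)]
      calc |γ * discMean γ α h a + p * examInd R c a - p * (γ * discN γ h a + examInd R c a)|
          = γ * |discMean γ α h a - p * discN γ h a| := by
            rw [← abs_of_nonneg hγ, ← abs_mul, abs_of_nonneg hγ]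
            congr 1
            ring
        _ ≤ γ * (γ ^ W / (1 - γ)) := by gcongr
        _ = γ ^ (W + 1) / (1 - γ) := by rw [pow_succ]; ring

end DiscountedStatistics

section Deviation

variable {L K : ℕ} {γ : ℝ} {α : ℕ → Fin L → ℝ}

/-- The exponential process, with tilt `r`, of the centred discounted click count
`discX - discMean`. By Hoeffding's lemma its expectation is at most `1`. -/
noncomputable def expTilt (γ : ℝ) (α : ℕ → Fin L → ℝ) (a : Fin L) (r : ℝ)
    (h : History L K) : ℝ :=
  Real.exp (r * (discX γ h a - discMean γ α h a) - r ^ 2 / 8 * discN γ h a)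

theorem expTilt_nonneg (a : Fin L) (r : ℝ) (h : History L K) : 0 ≤ expTilt γ α a r h :=
  (Real.exp_pos _).le

-- Discounting replaces the tilt `r` by `r * γ`; the quadratic terms compare since `γ ^ 2 ≤ γ`.
theorem bernExp_expTilt_cons_le (hγ : 0 ≤ γ) (hγ1 : γ ≤ 1) (a : Fin L) (r : ℝ)
    (R : RankedList L K) (h : History L K) (hα : ∀ b, α (h.length + 1) b ∈ Set.Icc 0 1) :
    bernExp (α (h.length + 1)) (fun v => expTilt γ α a r ((R, click R v) :: h)) ≤
      expTilt γ α a (r * γ) h := by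
  have hstep : ∀ v, expTilt γ α a r ((R, click R v) :: h) ≤ expTilt γ α a (r * γ) h *
      Real.exp (r * (clickInd R (click R v) a - α (h.length + 1) a * examInd R (click R v) a) -
        r ^ 2 / 8 * examInd R (click R v) a) := fun v => by
    have hquad : 0 ≤ r ^ 2 / 8 * discN γ h a * (γ * (1 - γ)) :=
      mul_nonneg (mul_nonneg (by positivity) (discN_nonneg hγ h a))
        (mul_nonneg hγ (sub_nonneg.2 hγ1))
    rw [expTilt, expTilt, ← Real.exp_add, Real.exp_le_exp, discN_cons, discX_cons, discMean]
    linarith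
  calc _ ≤ _ := bernExp_mono hα hstep
    _ = _ := bernExp_const_mul ..
    _ ≤ expTilt γ α a (r * γ) h :=
      mul_le_of_le_one_right (expTilt_nonneg ..) (bernExp_exp_le_one hα R a r)

/-- The tilt used for discounted counts in `[3/4 * 4 ^ k, 3/4 * 4 ^ (k + 1)]`, for deviations with
failure probability of order `exp (-l)`. -/
noncomputable def tilt (l : ℝ) (k : ℕ) : ℝ := 14 / 5 * (√l / √(3 / 4 * 4 ^ k))

theorem exists_grid_index {l N : ℝ} (hN : 3 / 4 ≤ N) (hNl : N ≤ Real.exp l) :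
    ∃ k < ⌈l⌉₊ + 1, 3 / 4 * 4 ^ k ≤ N ∧ N ≤ 3 / 4 * 4 ^ (k + 1) := by
  obtain ⟨k, hk, hk'⟩ := exists_nat_pow_near (x := N / (3 / 4)) (y := (4 : ℝ))
    (by rwa [one_le_div (by norm_num)]) (by norm_num)
  refine ⟨k, ?_, by linarith, by linarith⟩
  by_contra! hlt
  have hexp : Real.exp l ≤ 4 ^ ⌈l⌉₊ := calc
    Real.exp l ≤ Real.exp ⌈l⌉₊ := Real.exp_le_exp.2 (Nat.le_ceil l)
    _ = Real.exp 1 ^ ⌈l⌉₊ := by rw [← Real.exp_nat_mul, mul_one]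
    _ ≤ 4 ^ ⌈l⌉₊ := by gcongr; linarith [Real.exp_one_lt_d9]
  have hpow : (4 : ℝ) ^ (⌈l⌉₊ + 1) ≤ 4 ^ k := pow_le_pow_right₀ (by norm_num) hlt
  rw [pow_succ] at hpow
  linarith [Real.exp_pos l]

theorem tilt_exponent_ge {l N S : ℝ} {k : ℕ} (hl : 0 ≤ l) (hzN : 3 / 4 * 4 ^ k ≤ N)
    (hNz : N ≤ 3 / 4 * 4 ^ (k + 1)) (hdev : 9 / 8 * l * N ≤ S ^ 2) :
    49 / 25 * l ≤ tilt l k * |S| - tilt l k ^ 2 / 8 * N := by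
  set z : ℝ := 3 / 4 * 4 ^ k with hz
  have hz0 : 0 < z := by positivity
  have hN : 0 ≤ N := hz0.le.trans hzN
  have hsl := Real.sq_sqrt hl
  set s := √N / √z with hs
  have hs1 : 1 ≤ s := (one_le_div (Real.sqrt_pos.2 hz0)).2 (Real.sqrt_le_sqrt hzN)
  have hs2 : s ≤ 2 := by
    rw [hs, ← Real.sqrt_div' _ hz0.le, Real.sqrt_le_left (by norm_num), div_le_iff₀ hz0]
    rw [pow_succ] at hNz
    linarith
  have hS : 53 / 50 * (√l * √N) ≤ |S| := by
    refine (abs_le_of_sq_le_sq' ?_ (abs_nonneg S)).2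
    rw [sq_abs, mul_pow, mul_pow, hsl, Real.sq_sqrt hN]
    nlinarith [mul_nonneg hl hN]
  have hlinear : 742 / 250 * l * s ≤ tilt l k * |S| := by
    have htilt : 0 ≤ tilt l k := by unfold tilt; positivity
    refine le_trans (le_of_eq ?_) (mul_le_mul_of_nonneg_left hS htilt)
    rw [tilt, ← hz, hs]
    linear_combination (-(742 / 250) * (√N / √z)) * hsl
  have hquadratic : tilt l k ^ 2 / 8 * N = 49 / 50 * l * s ^ 2 := by
    rw [tilt, hs, ← hz, mul_pow, div_pow, div_pow, div_pow, hsl, Real.sq_sqrt hN,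
      Real.sq_sqrt hz0.le]
    ring
  rw [hquadratic]
  nlinarith [mul_nonneg hl (mul_nonneg (sub_nonneg.2 hs1) (sub_nonneg.2 hs2)),
    mul_nonneg hl (sub_nonneg.2 hs1)]

/-- Sum of the exponential processes over a geometric grid of tilts of both signs. It is large
whenever the deviation is large, whatever the size of the random discounted count. -/
noncomputable def expTiltSum (γ : ℝ) (α : ℕ → Fin L → ℝ) (a : Fin L) (l : ℝ)
    (h : History L K) : ℝ :=
  ∑ k ∈ Finset.range (⌈l⌉₊ + 1), (expTilt γ α a (tilt l k) h + expTilt γ α a (-tilt l k) h)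

theorem exp_le_expTiltSum {l : ℝ} (hl : 2 / 3 ≤ l) (a : Fin L) (h : History L K)
    (hN : 0 < discN γ h a) (hNl : discN γ h a ≤ Real.exp l)
    (hle : |discX γ h a - discMean γ α h a| ≤ discN γ h a)
    (hdev : 9 / 8 * l * discN γ h a ≤ (discX γ h a - discMean γ α h a) ^ 2) :
    Real.exp (49 / 25 * l) ≤ expTiltSum γ α a l h := by
  have hN' : 3 / 4 ≤ discN γ h a := by
    have hsq := sq_le_sq' (neg_le_of_abs_le hle) (le_of_abs_le hle)
    have := le_of_mul_le_mul_right (hdev.trans (hsq.trans_eq (sq _))) hN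
    linarith
  obtain ⟨k, hk, hzN, hNz⟩ := exists_grid_index hN' hNl
  have hexponent := tilt_exponent_ge (by linarith) hzN hNz hdev
  calc Real.exp (49 / 25 * l)
      ≤ expTilt γ α a (tilt l k) h + expTilt γ α a (-tilt l k) h := by
        rcases abs_cases (discX γ h a - discMean γ α h a) with ⟨habs, -⟩ | ⟨habs, -⟩
        · exact le_add_of_le_of_nonneg (Real.exp_le_exp.2 (by rwa [habs] at hexponent))
            (expTilt_nonneg ..)
        · exact le_add_of_nonneg_of_le (expTilt_nonneg ..)
            (Real.exp_le_exp.2 (by rw [habs] at hexponent; linarith))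
    _ ≤ expTiltSum γ α a l h :=
        Finset.single_le_sum
          (f := fun k => expTilt γ α a (tilt l k) h + expTilt γ α a (-tilt l k) h)
          (fun _ _ => add_nonneg (expTilt_nonneg ..) (expTilt_nonneg ..)) (Finset.mem_range.2 hk)

variable {Ω : Type u} [MeasurableSpace Ω] {μ : Measure Ω} [IsProbabilityMeasure μ] {n : ℕ}
  {A : ℕ → Ω → Fin L → Bool}

theorem IsEnvironment.integral_expTilt_le_one (hA : IsEnvironment μ n α A)
    (π : History L K → RankedList L K) (hγ : 0 ≤ γ) (hγ1 : γ ≤ 1) (a : Fin L) {t : ℕ}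
    (ht : t ≤ n) (r : ℝ) : ∫ ω, expTilt γ α a r (hist π (A · ω) t) ∂μ ≤ 1 := by
  induction t generalizing r with
  | zero => simp [hist, expTilt, discX, discMean, discN]
  | succ t ih =>
    have ht' : t ≤ n := t.le_succ.trans ht
    let G : History L K → (Fin L → Bool) → ℝ := fun h v =>
      expTilt γ α a r ((π h, click (π h) v) :: h)
    calc ∫ ω, expTilt γ α a r (hist π (A · ω) (t + 1)) ∂μ
        = ∫ ω, bernExp (α (t + 1)) (G (hist π (A · ω) t)) ∂μ := hA.integral_step π ht G
      _ ≤ ∫ ω, expTilt γ α a (r * γ) (hist π (A · ω) t) ∂μ := by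
        refine integral_mono (hA.integrable_hist π ht' fun h => bernExp (α (t + 1)) (G h))
          (hA.integrable_hist π ht' (expTilt γ α a (r * γ))) fun ω => ?_
        have hlen := length_hist π (A · ω) t
        have hstep := bernExp_expTilt_cons_le hγ hγ1 a r (π (hist π (A · ω) t))
          (hist π (A · ω) t) (α := α)
        rw [hlen] at hstep
        exact hstep fun b => hA.mem_Icc (Finset.mem_Icc.2 ⟨t.succ_pos, ht⟩) b
      _ ≤ 1 := ih ht' (r * γ)

theorem IsEnvironment.integral_expTiltSum_le (hA : IsEnvironment μ n α A)
    (π : History L K → RankedList L K) (hγ : 0 ≤ γ) (hγ1 : γ ≤ 1) (a : Fin L) {t : ℕ}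
    (ht : t ≤ n) {l : ℝ} (hl : 0 ≤ l) :
    ∫ ω, expTiltSum γ α a l (hist π (A · ω) t) ∂μ ≤ 2 * (l + 2) := by
  have hint : ∀ r, Integrable (fun ω => expTilt γ α a r (hist π (A · ω) t)) μ :=
    fun r => hA.integrable_hist π ht _
  have hle : ∀ r, ∫ ω, expTilt γ α a r (hist π (A · ω) t) ∂μ ≤ 1 :=
    hA.integral_expTilt_le_one π hγ hγ1 a ht
  simp only [expTiltSum]
  rw [integral_finsetSum _ fun k _ => (hint _).fun_add (hint _)]
  simp_rw [integral_add (hint _) (hint _)]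
  refine (Finset.sum_le_card_nsmul _ _ 2 fun k _ => ?_).trans ?_
  · linarith [hle (tilt l k), hle (-tilt l k)]
  · have := Nat.ceil_lt_add_one hl
    simp only [Finset.card_range, nsmul_eq_mul, Nat.cast_add, Nat.cast_one]
    linarith

theorem IsEnvironment.integral_indicator_deviation_le (hA : IsEnvironment μ n α A)
    (π : History L K → RankedList L K) (hγ : 0 ≤ γ) (hγ1 : γ < 1) (a : Fin L) {t : ℕ}
    (ht : t ≤ n) {l : ℝ} (hl : 2 / 3 ≤ l) (htl : horizon γ t ≤ Real.exp l)
    {E : Set (History L K)} (hE : ∀ h ∈ E, 0 < discN γ h a ∧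
      9 / 8 * l * discN γ h a ≤ (discX γ h a - discMean γ α h a) ^ 2) :
    ∫ ω, E.indicator 1 (hist π (A · ω) t) ∂μ ≤ 4 * Real.exp (-l) := by
  have hmarkov : ∀ ω, E.indicator 1 (hist π (A · ω) t) ≤
      Real.exp (-(49 / 25 * l)) * expTiltSum γ α a l (hist π (A · ω) t) := fun ω => by
    have hlen := length_hist π (A · ω) t
    generalize hist π (A · ω) t = h at hlen
    refine Set.indicator_apply_le' (fun hh => ?_) fun _ => mul_nonneg (Real.exp_pos _).le
      (Finset.sum_nonneg fun k _ => add_nonneg (expTilt_nonneg ..) (expTilt_nonneg ..))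
    rw [Pi.one_apply, Real.exp_neg, ← div_eq_inv_mul, one_le_div (Real.exp_pos _)]
    refine exp_le_expTiltSum hl a h (hE h hh).1
      ((discN_le_horizon hγ hγ1.ne h a).trans (hlen ▸ htl))
      (abs_discX_sub_discMean_le hγ h a fun s hs => hA.mem_Icc ?_ a) (hE h hh).2
    exact Finset.Icc_subset_Icc_right (hlen.trans_le ht) hs
  calc ∫ ω, E.indicator 1 (hist π (A · ω) t) ∂μ
      ≤ ∫ ω, Real.exp (-(49 / 25 * l)) * expTiltSum γ α a l (hist π (A · ω) t) ∂μ :=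
        integral_mono (hA.integrable_hist π ht (E.indicator 1))
          (hA.integrable_hist π ht fun h => _ * expTiltSum γ α a l h) hmarkov
    _ = Real.exp (-(49 / 25 * l)) * ∫ ω, expTiltSum γ α a l (hist π (A · ω) t) ∂μ :=
        integral_const_mul _ _
    _ ≤ Real.exp (-(49 / 25 * l)) * (2 * (2 * Real.exp (24 / 25 * l))) := by
        have := hA.integral_expTiltSum_le π hγ hγ1.le a ht (l := l) (by linarith)
        have := Real.add_one_le_exp (24 / 25 * l)
        gcongr
        linarith
    _ = 4 * Real.exp (-l) := by
        rw [show 4 * Real.exp (-l) = 4 * Real.exp (-(49 / 25 * l) + 24 / 25 * l) by ring_nf,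
          Real.exp_add]
        ring

end Deviation

section CappedGaps

theorem sum_card_filter_lt {ι M : Type*} [LinearOrder ι] [AddCommMonoid M] (S : Finset ι)
    (f : ℕ → M) : ∑ t ∈ S, f (S.filter (· < t)).card = ∑ i ∈ Finset.range S.card, f i := by
  induction S using Finset.induction_on_max with
  | empty => simp
  | insert m S hm ih =>
    have hmS : m ∉ S := fun h => lt_irrefl m (hm m h)
    rw [Finset.sum_insert hmS, Finset.card_insert_of_notMem hmS, Finset.sum_range_succ, ← ih,
      add_comm]
    congr 1
    · refine Finset.sum_congr rfl fun t ht => ?_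
      rw [Finset.filter_insert, if_neg (hm t ht).not_gt]
    · rw [Finset.filter_insert, if_neg (lt_irrefl m), Finset.filter_true_of_mem hm]

/-- The largest `g ∈ [0, 1]` with `g ^ 2 * x ≤ Y`: an upper bound for the gap of an item that is
shown by mistake after it has been examined (with discounting) `x` times. -/
noncomputable def gapCap (Y x : ℝ) : ℝ := √(Y / max x Y)

open Classical in
/-- The function `gapCap`, set to zero where it is smaller than `Δ`, since there an item with gap
at least `Δ` is no longer shown by mistake. -/
noncomputable def cutCap (Y Δ x : ℝ) : ℝ := if Δ ≤ gapCap Y x then gapCap Y x else 0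

variable {Y : ℝ}

theorem gapCap_nonneg (Y x : ℝ) : 0 ≤ gapCap Y x := Real.sqrt_nonneg _

theorem gapCap_le_one (hY : 0 ≤ Y) (x : ℝ) : gapCap Y x ≤ 1 :=
  Real.sqrt_le_one.2 (div_le_one_of_le₀ (le_max_right ..) (hY.trans (le_max_right ..)))

theorem gapCap_antitone (hY : 0 < Y) : Antitone (gapCap Y) := fun _ _ hxy =>
  Real.sqrt_le_sqrt (div_le_div_of_nonneg_left hY.le (hY.trans_le (le_max_right ..))
    (max_le_max_right Y hxy))

theorem le_gapCap {x g : ℝ} (hY : 0 < Y) (hg : g ∈ Set.Icc 0 1) (h : g ^ 2 * x ≤ Y) :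
    g ≤ gapCap Y x := by
  refine Real.le_sqrt_of_sq_le ((le_div_iff₀ (hY.trans_le (le_max_right ..))).2 ?_)
  rw [mul_max_of_nonneg _ _ (sq_nonneg g)]
  exact max_le h (mul_le_of_le_one_left hY.le (pow_le_one₀ hg.1 hg.2))

theorem cutCap_nonneg (Y Δ x : ℝ) : 0 ≤ cutCap Y Δ x := by
  unfold cutCap
  split_ifs
  exacts [gapCap_nonneg .., le_rfl]

theorem cutCap_le_gapCap (Y Δ x : ℝ) : cutCap Y Δ x ≤ gapCap Y x := by
  unfold cutCap
  split_ifs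
  exacts [le_rfl, gapCap_nonneg ..]

theorem cutCap_antitone (hY : 0 < Y) (Δ : ℝ) : Antitone (cutCap Y Δ) := by
  intro x y hxy
  have h := gapCap_antitone hY hxy
  unfold cutCap
  split_ifs with hy hx hx
  exacts [h, absurd (hy.trans h) hx, gapCap_nonneg .., le_rfl]

theorem le_cutCap {x g Δ : ℝ} (hY : 0 < Y) (hΔ : Δ ≤ g) (hg : g ∈ Set.Icc 0 1)
    (h : g ^ 2 * x ≤ Y) : g ≤ cutCap Y Δ x := by
  have hcap := le_gapCap hY hg h
  rwa [cutCap, if_pos (hΔ.trans hcap)]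

theorem cutCap_mul {c : ℝ} (hc : 0 < c) (Δ x : ℝ) :
    cutCap Y Δ (c * x) = cutCap (Y / c) Δ x := by
  have h : gapCap Y (c * x) = gapCap (Y / c) x := by
    rw [gapCap, gapCap, div_div, mul_max_of_nonneg _ _ hc.le, mul_div_cancel₀ _ hc.ne']
  simp only [cutCap, h]

theorem le_div_sq_of_cutCap_ne_zero {Δ x : ℝ} (hY : 0 < Y) (hΔ : 0 < Δ)
    (h : cutCap Y Δ x ≠ 0) : x ≤ Y / Δ ^ 2 := by
  have hmax : 0 < max x Y := hY.trans_le (le_max_right ..)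
  have hle : Δ ≤ gapCap Y x := by
    by_contra hlt
    exact h (if_neg hlt)
  rw [gapCap, Real.le_sqrt' hΔ, le_div_iff₀ hmax] at hle
  rw [le_div_iff₀' (pow_pos hΔ 2)]
  exact (mul_le_mul_of_nonneg_left (le_max_left ..) (sq_nonneg Δ)).trans hle

theorem div_sqrt_succ_le (c : ℝ) (hc : 0 ≤ c) (J : ℕ) :
    c / √((J + 1 : ℕ) : ℝ) ≤ 2 * c * (√((J + 1 : ℕ) : ℝ) - √J) := by
  rw [div_le_iff₀ (Real.sqrt_pos.2 (by positivity))]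
  have hsucc : √((J + 1 : ℕ) : ℝ) ^ 2 = J + 1 := by
    rw [Real.sq_sqrt (by positivity), Nat.cast_add_one]
  have hJ : √(J : ℝ) ^ 2 = J := Real.sq_sqrt (by positivity)
  have hone : 1 ≤ 2 * (√((J + 1 : ℕ) : ℝ) - √J) * √((J + 1 : ℕ) : ℝ) := by
    nlinarith [sq_nonneg (√((J + 1 : ℕ) : ℝ) - √J)]
  linarith [mul_le_mul_of_nonneg_left hone hc]

theorem sum_gapCap_le (hY : 0 ≤ Y) {J : ℕ} (hJ : ⌊Y⌋₊ ≤ J) :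
    ∑ j ∈ Finset.range (J + 1), gapCap Y j ≤
      ⌊Y⌋₊ + 1 + 2 * √Y * (√J - √(⌊Y⌋₊ : ℝ)) := by
  induction J, hJ using Nat.le_induction with
  | base =>
    simpa using Finset.sum_le_card_nsmul (Finset.range (⌊Y⌋₊ + 1)) (fun j : ℕ => gapCap Y j) 1
      fun j _ => gapCap_le_one hY j
  | succ J hJ ih =>
    have hYJ : Y ≤ (J + 1 : ℕ) :=
      (Nat.lt_floor_add_one Y).le.trans (by exact_mod_cast Nat.succ_le_succ hJ)
    have hlast := div_sqrt_succ_le (√Y) (Real.sqrt_nonneg Y) J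
    rw [Finset.sum_range_succ, gapCap, max_eq_left hYJ, Real.sqrt_div hY]
    linarith

theorem sum_cutCap_le {Δ : ℝ} (hY : 0 < Y) (hΔ : 0 < Δ) (hΔ1 : Δ ≤ 1) (J : ℕ) :
    ∑ j ∈ Finset.range J, cutCap Y Δ j ≤ 2 * Y / Δ - Y + 2 := by
  set Q := ⌊Y / Δ ^ 2⌋₊
  have hfloor : (Q : ℝ) ≤ Y / Δ ^ 2 := Nat.floor_le (by positivity)
  have hYΔ : Y ≤ Y / Δ ^ 2 :=
    le_div_self hY.le (by positivity) (pow_le_one₀ hΔ.le hΔ1)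
  have htrunc : ∑ j ∈ Finset.range J, cutCap Y Δ j ≤ ∑ j ∈ Finset.range (Q + 1), gapCap Y j := by
    rw [← Finset.sum_filter_ne_zero]
    refine (Finset.sum_le_sum_of_subset_of_nonneg (fun j hj => ?_)
      fun j _ _ => cutCap_nonneg ..).trans (Finset.sum_le_sum fun j _ => cutCap_le_gapCap ..)
    exact Finset.mem_range.2 (Nat.lt_succ_iff.2 (Nat.le_floor
      (le_div_sq_of_cutCap_ne_zero hY hΔ (Finset.mem_filter.1 hj).2)))
  have hsum := sum_gapCap_le hY.le (J := Q) (Nat.floor_le_floor hYΔ)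
  have hQΔ : √Y * √Q ≤ Y / Δ := by
    rw [← Real.sqrt_mul hY.le]
    refine Real.sqrt_le_iff.2 ⟨by positivity, ?_⟩
    calc Y * Q ≤ Y * (Y / Δ ^ 2) := by gcongr
      _ = (Y / Δ) ^ 2 := by ring
  have hYfloor : (⌊Y⌋₊ : ℝ) ≤ √Y * √(⌊Y⌋₊ : ℝ) := by
    have hsqrt : √(⌊Y⌋₊ : ℝ) ≤ √Y := Real.sqrt_le_sqrt (Nat.floor_le hY.le)
    have hself : √(⌊Y⌋₊ : ℝ) * √(⌊Y⌋₊ : ℝ) = ⌊Y⌋₊ := Real.mul_self_sqrt (by positivity)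
    nlinarith [Real.sqrt_nonneg (⌊Y⌋₊ : ℝ)]
  have hlt := Nat.lt_floor_add_one Y
  rw [mul_div_assoc]
  nlinarith

theorem sum_cutCap_le_of_card_le {ι : Type*} [LinearOrder ι] {c Δ : ℝ} (hY : 0 < Y) (hc : 0 < c)
    (hΔ : 0 < Δ) (hΔ1 : Δ ≤ 1) (S : Finset ι) (N : ι → ℝ)
    (hN : ∀ t ∈ S, c * (S.filter (· < t)).card ≤ N t) :
    ∑ t ∈ S, cutCap Y Δ (N t) ≤ 2 * (Y / c) / Δ - Y / c + 2 := calc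
  ∑ t ∈ S, cutCap Y Δ (N t) ≤ ∑ t ∈ S, cutCap (Y / c) Δ (S.filter (· < t)).card :=
    Finset.sum_le_sum fun t ht => by
      rw [← cutCap_mul hc]
      exact cutCap_antitone hY Δ (hN t ht)
  _ = ∑ i ∈ Finset.range S.card, cutCap (Y / c) Δ i :=
    sum_card_filter_lt S fun i => cutCap (Y / c) Δ i
  _ ≤ 2 * (Y / c) / Δ - Y / c + 2 := sum_cutCap_le (div_pos hY hc) hΔ hΔ1 _

variable {L K : ℕ} (π : History L K → RankedList L K) (A : ℕ → Fin L → Bool)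

/-- The indicator that item `a` is examined at step `t`. -/
noncomputable def examAt (t : ℕ) (a : Fin L) : ℝ :=
  examInd (shown π A t) (click (shown π A t) (A t)) a

theorem discN_hist (γ : ℝ) (t : ℕ) (a : Fin L) :
    discN γ (hist π A t) a = ∑ s ∈ Finset.Icc 1 t, γ ^ (t - s) * examAt π A s a := by
  induction t with
  | zero => simp [hist, discN]
  | succ t ih =>
    rw [hist, discN_cons, ih, Finset.sum_Icc_succ_top t.succ_pos, Finset.mul_sum, Nat.sub_self,
      pow_zero, one_mul]
    congr 1
    refine Finset.sum_congr rfl fun s hs => ?_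
    rw [Nat.succ_sub (Finset.mem_Icc.1 hs).2, pow_succ', mul_assoc]

theorem rpow_mul_card_le_discN {γ : ℝ} (hγ : 0 < γ) (hγ1 : γ ≤ 1) {a : Fin L} {S : Finset ℕ}
    {t : ℕ} {m : ℝ} (hSt : S ⊆ Finset.Icc 1 t) (hexam : ∀ s ∈ S, examAt π A s a = 1)
    (hrecent : ∀ s ∈ S, (t : ℝ) - s ≤ m) : γ ^ m * S.card ≤ discN γ (hist π A t) a := by
  rw [discN_hist]
  calc γ ^ m * S.card = ∑ _s ∈ S, γ ^ m := by simp [mul_comm]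
    _ ≤ ∑ s ∈ S, γ ^ (t - s) * examAt π A s a := Finset.sum_le_sum fun s hs => by
        rw [hexam s hs, mul_one, ← Real.rpow_natCast,
          Nat.cast_sub (Finset.mem_Icc.1 (hSt hs)).2]
        exact Real.rpow_le_rpow_of_exponent_ge hγ hγ1 (hrecent s hs)
    _ ≤ ∑ s ∈ Finset.Icc 1 t, γ ^ (t - s) * examAt π A s a :=
        Finset.sum_le_sum_of_subset_of_nonneg hSt fun s _ _ =>
          mul_nonneg (pow_nonneg hγ.le _) (examInd_nonneg ..)

theorem sum_examAt_mul (S : Finset ℕ) (a : Fin L) (f : ℕ → ℝ) :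
    ∑ t ∈ S, examAt π A t a * f t = ∑ t ∈ S with examAt π A t a = 1, f t := by
  rw [Finset.sum_filter]
  refine Finset.sum_congr rfl fun t _ => ?_
  rcases examInd_eq_zero_or_one (shown π A t) (click (shown π A t) (A t)) a with h | h <;>
    simp [examAt, h]

-- Blocks of length `1 / (1 - γ)`: within a block discounting costs at most `γ ^ (1 / (1 - γ))`.
theorem sum_examAt_cutCap_le {γ : ℝ} (hγ : 0 < γ) (hγ1 : γ < 1) (n : ℕ) (a : Fin L) {Δ : ℝ}
    (hY : 0 < Y) (hΔ : 0 < Δ) (hΔ1 : Δ ≤ 1) :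
    ∑ t ∈ Finset.Icc 1 n, examAt π A t a * cutCap Y Δ (discN γ (hist π A (t - 1)) a) ≤
      ⌈(n : ℝ) * (1 - γ)⌉₊ *
        (2 * (Y / γ ^ (1 / (1 - γ))) / Δ - Y / γ ^ (1 / (1 - γ)) + 2) := by
  have hx : 0 < 1 - γ := sub_pos.2 hγ1
  let block : ℕ → ℕ := fun t => ⌈(t : ℝ) * (1 - γ)⌉₊
  have hmaps : ∀ t ∈ (Finset.Icc 1 n).filter (examAt π A · a = 1),
      block t ∈ Finset.Icc 1 (block n) := by
    intro t ht
    obtain ⟨h1, htn⟩ := Finset.mem_Icc.1 (Finset.mem_filter.1 ht).1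
    refine Finset.mem_Icc.2 ⟨Nat.one_le_ceil_iff.2 (mul_pos (by exact_mod_cast h1) hx), ?_⟩
    exact Nat.ceil_mono (mul_le_mul_of_nonneg_right (by exact_mod_cast htn) hx.le)
  rw [sum_examAt_mul, ← Finset.sum_fiberwise_of_maps_to hmaps]
  refine (Finset.sum_le_card_nsmul _ _ _ fun k _ => ?_).trans
    (by rw [Nat.card_Icc, Nat.add_sub_cancel, nsmul_eq_mul])
  refine sum_cutCap_le_of_card_le hY (Real.rpow_pos_of_pos hγ _) hΔ hΔ1 _ _ fun t ht => ?_
  simp only [Finset.mem_filter, Finset.mem_Icc] at ht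
  refine rpow_mul_card_le_discN π A hγ hγ1.le (fun s hs => ?_) (fun s hs => ?_) fun s hs => ?_
  all_goals simp only [Finset.mem_filter, Finset.mem_Icc] at hs
  · rw [Finset.mem_Icc]
    omega
  · exact hs.1.1.2
  · have hs1 := Nat.ceil_lt_add_one (show 0 ≤ (s : ℝ) * (1 - γ) by positivity)
    have ht1 := Nat.le_ceil ((t : ℝ) * (1 - γ))
    have hblock : (block t : ℝ) = block s := by rw [ht.2, hs.1.2]
    simp only [block] at hblock
    rw [le_div_iff₀ hx, Nat.cast_sub ht.1.1.1, Nat.cast_one]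
    nlinarith

end CappedGaps

section Loss

variable {L K : ℕ} {p : Fin L → ℝ}

theorem sum_mul_examProb_le_one (hp : ∀ a, p a ≤ 1) (e : RankedList L K) :
    ∑ k, p (e k) * examProb p e k ≤ 1 := by
  have htotal := Finset.prod_one_sub_ordered Finset.univ fun k => p (e k)
  have hnonneg : 0 ≤ ∏ k, (1 - p (e k)) := Finset.prod_nonneg fun k _ => sub_nonneg.2 (hp (e k))
  simp only [examProb]
  linarith

theorem reward_eq_of_map_eq {d e : RankedList L K} (h : Finset.univ.map d = Finset.univ.map e)
    (p : Fin L → ℝ) : reward d p = reward e p := by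
  simp only [reward, ← Finset.prod_map Finset.univ d fun a => 1 - p a,
    ← Finset.prod_map Finset.univ e fun a => 1 - p a, h]

theorem exists_antitone_enum (p : Fin L → ℝ) {D : Finset (Fin L)} (hD : D.card = K) :
    ∃ e : RankedList L K, Finset.univ.map e = D ∧ Antitone fun k => p (e k) := by
  let f := (D.equivFinOfCardEq hD).symm
  let σ := Tuple.sort fun i => -p (f i)
  refine ⟨(σ.trans f).toEmbedding.trans (Function.Embedding.subtype _), ?_, fun i j hij => ?_⟩
  · exact Finset.eq_of_subset_of_card_le (fun a ha => by aesop) (by simp [hD])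
  · simpa using Tuple.monotone_sort (fun i => -p (f i)) hij

theorem exists_matching (R : RankedList L K) {D : Finset (Fin L)} (hD : D.card = K) :
    ∃ d : RankedList L K, Finset.univ.map d = D ∧ ∀ i, R i ∈ D → d i = R i := by
  obtain ⟨d, hd⟩ := Finset.exists_equiv_extend_of_card_eq (t := D)
    (s := Finset.univ.filter fun i => R i ∈ D) (f := R) (by simp [hD])
    (fun a ha => by aesop) R.injective.injOn
  refine ⟨d.toEmbedding.trans (Function.Embedding.subtype _), ?_, fun i hi => hd i (by simpa)⟩
  exact Finset.eq_of_subset_of_card_le (fun a ha => by aesop) (by simp [hD])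

theorem reward_sub_reward (p : Fin L → ℝ) (d R : RankedList L K) :
    reward d p - reward R p =
      ∑ i, (p (d i) - p (R i)) * examProb p R i * ∏ j with i < j, (1 - p (d j)) := by
  have h := Finset.prod_sub_ordered Finset.univ (fun i => 1 - p (d i)) fun i => p (R i) - p (d i)
  simp only [sub_sub, add_sub_cancel] at h
  rw [reward, reward, sub_sub_sub_cancel_left, h, sub_sub_cancel_left, ← Finset.sum_neg_distrib]
  exact Finset.sum_congr rfl fun i _ => by rw [examProb]; ring

theorem reward_le_of_isTopK (hp : ∀ a, p a ≤ 1) {e : RankedList L K}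
    (he : IsTopK K p (Finset.univ.map e)) (R : RankedList L K) : reward R p ≤ reward e p := by
  obtain ⟨d, hde, hdR⟩ := exists_matching R he.1
  rw [← reward_eq_of_map_eq hde, reward, reward]
  refine sub_le_sub_left (Finset.prod_le_prod (fun i _ => sub_nonneg.2 (hp (d i))) fun i _ => ?_) 1
  by_cases hi : R i ∈ Finset.univ.map e
  · rw [hdR i hi]
  · exact sub_le_sub_left (he.2 (d i) (hde ▸ by simp) (R i) hi) 1

theorem iSup_reward_le (hp : ∀ a, p a ≤ 1) {e : RankedList L K}
    (he : IsTopK K p (Finset.univ.map e)) : ⨆ R : RankedList L K, reward R p ≤ reward e p :=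
  have : Nonempty (RankedList L K) := ⟨e⟩
  ciSup_le (reward_le_of_isTopK hp he)

theorem exists_first_missing {e R : RankedList L K}
    (hne : Finset.univ.map R ≠ Finset.univ.map e) :
    ∃ k₀, (∀ j, R j ≠ e k₀) ∧ ∀ k < k₀, ∃ j, R j = e k := by
  have hex : ∃ k, ∀ j, R j ≠ e k := by
    by_contra! hall
    exact hne (Finset.eq_of_subset_of_card_le (fun a ha => by aesop) (by simp)).symm
  obtain ⟨k₀, hk₀, hmin⟩ := WellFounded.has_min (wellFounded_lt (α := Fin K))
    {k | ∀ j, R j ≠ e k} hex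
  refine ⟨k₀, hk₀, fun k hk => ?_⟩
  by_contra! hmissing
  exact hmin k hmissing hk

variable {e d R : RankedList L K} {k₀ : Fin K}

theorem le_of_matching (hanti : Antitone fun k => p (e k))
    (hde : Finset.univ.map d = Finset.univ.map e)
    (hdR : ∀ i, R i ∈ Finset.univ.map e → d i = R i) (hk₀ : ∀ k < k₀, ∃ j, R j = e k) {i : Fin K}
    (hi : R i ∉ Finset.univ.map e) : p (d i) ≤ p (e k₀) := by
  obtain ⟨k, -, hk⟩ := Finset.mem_map.1 (hde ▸ Finset.mem_map_of_mem d (Finset.mem_univ i))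
  rw [← hk]
  refine hanti (le_of_not_gt fun hlt => ?_)
  obtain ⟨j, hj⟩ := hk₀ k hlt
  have hji : d j = d i := (hdR j (by simp [hj])).trans (hj.trans hk)
  obtain rfl := d.injective hji
  exact hi (by simp [hj])

theorem reward_sub_reward_le_sum_gap (hp : ∀ a, p a ∈ Set.Icc 0 1)
    (he : IsTopK K p (Finset.univ.map e)) (hanti : Antitone fun k => p (e k))
    (hk₀ : ∀ k < k₀, ∃ j, R j = e k) :
    reward e p - reward R p ≤
      ∑ i with R i ∉ Finset.univ.map e, (p (e k₀) - p (R i)) * examProb p R i := by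
  obtain ⟨d, hde, hdR⟩ := exists_matching R he.1
  rw [← reward_eq_of_map_eq hde, reward_sub_reward, Finset.sum_filter]
  refine Finset.sum_le_sum fun i _ => ?_
  split_ifs with hi
  · rw [hdR i hi, sub_self, zero_mul, zero_mul]
  · have hexam := examProb_nonneg (fun a => (hp a).2) R i
    have hgap : 0 ≤ p (e k₀) - p (R i) := sub_nonneg.2 (he.2 _ (by simp) (R i) hi)
    have hmatch : p (d i) ≤ p (e k₀) := le_of_matching hanti hde hdR hk₀ hi
    calc (p (d i) - p (R i)) * examProb p R i * ∏ j with i < j, (1 - p (d j))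
        ≤ (p (e k₀) - p (R i)) * examProb p R i * ∏ j with i < j, (1 - p (d j)) := by
          gcongr
          exact Finset.prod_nonneg fun j _ => sub_nonneg.2 (hp (d j)).2
      _ ≤ (p (e k₀) - p (R i)) * examProb p R i :=
          mul_le_of_le_one_right (mul_nonneg hgap hexam) (Finset.prod_le_one
            (fun j _ => sub_nonneg.2 (hp (d j)).2) fun j _ => sub_le_self 1 (hp (d j)).1)

theorem prod_le_prod_of_injOn {ι κ : Type*} [Fintype ι] {c : ι → ℝ} (hc : ∀ i, c i ∈ Set.Icc 0 1)
    {s : Finset κ} {g : κ → ι} (hg : Set.InjOn g s) : ∏ i, c i ≤ ∏ k ∈ s, c (g k) := by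
  classical
  rw [← Finset.prod_image hg, ← Finset.prod_sdiff (Finset.subset_univ (s.image g))]
  exact mul_le_of_le_one_left (Finset.prod_nonneg fun i _ => (hc i).1)
    (Finset.prod_le_one (fun i _ => (hc i).1) fun i _ => (hc i).2)

-- The items `e k`, `k < k₀`, all occur among those listed before position `i` and those matched
-- with positions after `i`.
theorem examProb_mul_prod_later_le (hp : ∀ a, p a ∈ Set.Icc 0 1)
    (hdR : ∀ i, R i ∈ Finset.univ.map e → d i = R i) (hk₀ : ∀ k < k₀, ∃ j, R j = e k) {i : Fin K}
    (hi : R i ∉ Finset.univ.map e) :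
    examProb p R i * ∏ j with i < j, (1 - p (d j)) ≤ examProb p e k₀ := by
  have hp' : ∀ a, 1 - p a ∈ Set.Icc 0 1 := fun a => Set.Icc.one_sub_mem (hp a)
  let c : Fin K → ℝ := fun j =>
    (if j < i then 1 - p (R j) else 1) * if i < j then 1 - p (d j) else 1
  have hc : examProb p R i * ∏ j with i < j, (1 - p (d j)) = ∏ j, c j := by
    simp only [c, examProb, Finset.prod_mul_distrib, Finset.prod_filter]
  have hc01 : ∀ j, c j ∈ Set.Icc 0 1 := fun j => by
    refine unitInterval.mul_mem ?_ ?_ <;> split_ifs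
    exacts [hp' _, unitInterval.one_mem, hp' _, unitInterval.one_mem]
  choose! g hg using hk₀
  have hinj : Set.InjOn g (Finset.univ.filter (· < k₀)) := fun k hk k' hk' hkk' => by
    simp only [Finset.coe_filter, Finset.mem_univ, true_and, Set.mem_ofPred_eq] at hk hk'
    exact e.injective (by rw [← hg k hk, ← hg k' hk', hkk'])
  rw [hc]
  refine (prod_le_prod_of_injOn hc01 hinj).trans_eq (Finset.prod_congr rfl fun k hk => ?_)
  have hgk := hg k (Finset.mem_filter.1 hk).2
  have hgD : R (g k) ∈ Finset.univ.map e := by simp [hgk]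
  rcases lt_or_gt_of_ne fun h : g k = i => hi (h ▸ hgD) with h | h
  · simp [c, h, h.not_gt, hgk]
  · simp [c, h, h.not_gt, hdR _ hgD, hgk]

theorem card_filter_notMem_le (hKL : K ≤ L) (R : RankedList L K) {D : Finset (Fin L)}
    (hD : D.card = K) : ((Finset.univ.filter fun i => R i ∉ D).card : ℝ) ≤ (L : ℝ) - K := by
  have hle : (Finset.univ.filter fun i => R i ∉ D).card ≤ Dᶜ.card :=
    Finset.card_le_card_of_injOn R (fun i hi => by simpa using hi) R.injective.injOn
  rw [Finset.card_compl, hD, Fintype.card_fin] at hle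
  rw [← Nat.cast_sub hKL]
  exact_mod_cast hle

theorem reward_sub_reward_le_mul_examProb (hKL : K ≤ L) (hp : ∀ a, p a ∈ Set.Icc 0 1)
    (he : IsTopK K p (Finset.univ.map e)) (hanti : Antitone fun k => p (e k))
    (hk₀ : ∀ k < k₀, ∃ j, R j = e k) :
    reward e p - reward R p ≤ (L - K) * (p (e k₀) * examProb p e k₀) := by
  obtain ⟨d, hde, hdR⟩ := exists_matching R he.1
  have hterm0 : 0 ≤ p (e k₀) * examProb p e k₀ :=
    mul_nonneg (hp _).1 (examProb_nonneg (fun a => (hp a).2) e k₀)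
  calc reward e p - reward R p
      = ∑ i, (p (d i) - p (R i)) * examProb p R i * ∏ j with i < j, (1 - p (d j)) := by
        rw [← reward_eq_of_map_eq hde, reward_sub_reward]
    _ ≤ ∑ i with R i ∉ Finset.univ.map e, p (e k₀) * examProb p e k₀ := by
        rw [Finset.sum_filter]
        refine Finset.sum_le_sum fun i _ => ?_
        split_ifs with hi
        · rw [hdR i hi, sub_self, zero_mul, zero_mul]
        · have hmatch : p (d i) ≤ p (e k₀) := le_of_matching hanti hde hdR hk₀ hi
          rw [mul_assoc]
          exact mul_le_mul (by linarith [(hp (R i)).1]) (examProb_mul_prod_later_le hp hdR hk₀ hi)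
            (mul_nonneg (examProb_nonneg (fun a => (hp a).2) R i)
              (Finset.prod_nonneg fun j _ => sub_nonneg.2 (hp (d j)).2)) (hp _).1
    _ ≤ (L - K) * (p (e k₀) * examProb p e k₀) := by
        rw [Finset.sum_const, nsmul_eq_mul]
        exact mul_le_mul_of_nonneg_right (card_filter_notMem_le hKL R he.1) hterm0

theorem sum_filter_notMem_le_sum_compl (R : RankedList L K) (D : Finset (Fin L)) {f : Fin L → ℝ}
    (hf : ∀ a, 0 ≤ f a) : ∑ i with R i ∉ D, f (R i) ≤ ∑ a ∈ Dᶜ, f a := by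
  rw [← Finset.sum_map _ R]
  exact Finset.sum_le_sum_of_subset_of_nonneg (fun a ha => by aesop) fun a _ _ => hf a

-- Charge the loss to the best optimal item that is missing from `R`. If its radius holds, every
-- suboptimal item of `R` whose radius holds has gap at most `ψ`; if its radius fails, each of the
-- at most `L - K` misplaced items costs at most the probability that this item would be clicked.
theorem reward_sub_reward_le (hKL : K ≤ L) (hp : ∀ a, p a ∈ Set.Icc 0 1)
    (he : IsTopK K p (Finset.univ.map e)) (hanti : Antitone fun k => p (e k)) {F : Set (Fin L)}
    {ψ : Fin L → ℝ} (hψ : ∀ a, 0 ≤ ψ a)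
    (hgood : ∀ i k, R i ∉ Finset.univ.map e → R i ∉ F → (∀ j, R j ≠ e k) → e k ∉ F →
      p (e k) - p (R i) ≤ ψ (R i)) :
    reward e p - reward R p ≤
      ∑ i with R i ∉ Finset.univ.map e, ψ (R i) * examProb p R i +
        ∑ a ∈ (Finset.univ.map e)ᶜ, F.indicator 1 a +
        (L - K) * ∑ k, F.indicator 1 (e k) * (p (e k) * examProb p e k) := by
  have hexam : ∀ (R : RankedList L K) i, 0 ≤ examProb p R i :=
    examProb_nonneg fun a => (hp a).2
  have hF : ∀ a, (0 : ℝ) ≤ F.indicator 1 a := Set.indicator_nonneg fun _ _ => zero_le_one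
  have hmissing : ∀ k, 0 ≤ F.indicator 1 (e k) * (p (e k) * examProb p e k) := fun k =>
    mul_nonneg (hF _) (mul_nonneg (hp _).1 (hexam e k))
  have hLK : (0 : ℝ) ≤ L - K := sub_nonneg.2 (by exact_mod_cast hKL)
  have hgap0 : 0 ≤ ∑ i with R i ∉ Finset.univ.map e, ψ (R i) * examProb p R i :=
    Finset.sum_nonneg fun i _ => mul_nonneg (hψ _) (hexam R i)
  have hshown0 : (0 : ℝ) ≤ ∑ a ∈ (Finset.univ.map e)ᶜ, F.indicator 1 a :=
    Finset.sum_nonneg fun a _ => hF a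
  have hmissing0 := mul_nonneg hLK (Finset.sum_nonneg fun k (_ : k ∈ Finset.univ) => hmissing k)
  by_cases hne : Finset.univ.map R = Finset.univ.map e
  · rw [reward_eq_of_map_eq hne, sub_self]
    positivity
  obtain ⟨k₀, hk₀, hbefore⟩ := exists_first_missing hne
  by_cases hk₀F : e k₀ ∈ F
  · have hsingle := Finset.single_le_sum (fun k _ => hmissing k) (Finset.mem_univ k₀)
    rw [Set.indicator_of_mem hk₀F, Pi.one_apply, one_mul] at hsingle
    have hloss := reward_sub_reward_le_mul_examProb (R := R) hKL hp he hanti hbefore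
    linarith [mul_le_mul_of_nonneg_left hsingle hLK]
  · have hterm : ∀ i ∈ Finset.univ.filter fun i => R i ∉ Finset.univ.map e,
        (p (e k₀) - p (R i)) * examProb p R i ≤
          ψ (R i) * examProb p R i + F.indicator 1 (R i) := fun i hi => by
      by_cases hiF : R i ∈ F
      · rw [Set.indicator_of_mem hiF, Pi.one_apply]
        have hle : (p (e k₀) - p (R i)) * examProb p R i ≤ 1 := mul_le_one₀
          (by linarith [(hp (e k₀)).2, (hp (R i)).1]) (hexam R i) (examProb_le_one hp R i)
        linarith [mul_nonneg (hψ (R i)) (hexam R i)]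
      · rw [Set.indicator_of_notMem hiF, add_zero]
        exact mul_le_mul_of_nonneg_right
          (hgood i k₀ (Finset.mem_filter.1 hi).2 hiF hk₀ hk₀F) (hexam R i)
    have hsum := Finset.sum_le_sum hterm
    rw [Finset.sum_add_distrib] at hsum
    linarith [reward_sub_reward_le_sum_gap (R := R) hp he hanti hbefore,
      sum_filter_notMem_le_sum_compl R (Finset.univ.map e) hF]

end Loss

section ConfidenceRadius

variable {L K : ℕ} {γ ε : ℝ} {p : Fin L → ℝ} {h : History L K} {a b : Fin L}

theorem one_le_horizon_succ (hγ : 0 ≤ γ) (hγ1 : γ < 1) (t : ℕ) : 1 ≤ horizon γ (t + 1) := by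
  rw [horizon, one_le_div (sub_pos.2 hγ1)]
  exact sub_le_sub_left (pow_le_of_le_one hγ hγ1.le t.succ_ne_zero) 1

theorem one_div_horizon_le (hγ : 0 ≤ γ) (hγ1 : γ < 1) {t : ℕ} (ht : 1 ≤ t) :
    1 / horizon γ t ≤ 1 / t + (1 - γ) := by
  have ht0 : (0 : ℝ) < t := by exact_mod_cast ht
  have hpow : γ ^ t < 1 := pow_lt_one₀ hγ hγ1 (by omega)
  have hbernoulli : γ ^ t * (1 + t * (1 - γ)) ≤ 1 := calc
    γ ^ t * (1 + t * (1 - γ)) ≤ Real.exp (-(1 - γ)) ^ t * Real.exp (t * (1 - γ)) := by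
      have hγexp := Real.add_one_le_exp (-(1 - γ))
      have hexp := Real.add_one_le_exp (t * (1 - γ))
      have : 0 < 1 - γ := sub_pos.2 hγ1
      gcongr <;> linarith
    _ = 1 := by rw [← Real.exp_nat_mul, ← Real.exp_add, mul_neg, neg_add_cancel, Real.exp_zero]
  rw [horizon, one_div_div, div_add' _ _ _ ht0.ne', div_le_div_iff₀ (sub_pos.2 hpow) ht0]
  linarith

theorem two_thirds_le_log_horizon (hγ : 99 / 100 ≤ γ) (hγ1 : γ < 1) {t : ℕ} (ht : 2 ≤ t) :
    2 / 3 ≤ Real.log (horizon γ t) := by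
  have hhorizon : 199 / 100 ≤ horizon γ t := by
    rw [horizon, le_div_iff₀ (sub_pos.2 hγ1)]
    nlinarith [pow_le_pow_of_le_one (by linarith) hγ1.le ht]
  have hsplit : Real.log 2 + Real.log (199 / 200) ≤ Real.log (horizon γ t) := by
    rw [← Real.log_mul (by norm_num) (by norm_num)]
    exact Real.log_le_log (by norm_num) (by linarith)
  have hlog := Real.one_sub_inv_le_log_of_pos (show (0 : ℝ) < 199 / 200 by norm_num)
  norm_num at hlog
  linarith [Real.log_two_gt_d9]

/-- The items whose discounted click rate after the history `h` differs from `p` by more than the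
confidence radius. -/
def failingItems (γ ε : ℝ) (p : Fin L → ℝ) (h : History L K) : Set (Fin L) :=
  {a | 0 < discN γ h a ∧ 2 * √(ε * Real.log (horizon γ (h.length + 1)) / discN γ h a) <
    |discX γ h a / discN γ h a - p a|}

theorem abs_sub_le_of_notMem_failingItems (hN : 0 < discN γ h a)
    (ha : a ∉ failingItems γ ε p h) : |discX γ h a / discN γ h a - p a| ≤
      2 * √(ε * Real.log (horizon γ (h.length + 1)) / discN γ h a) :=
  not_lt.1 fun hlt => ha ⟨hN, hlt⟩

theorem ucb_of_pos (hN : 0 < discN γ h a) : ucb γ ε h a = discX γ h a / discN γ h a +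
    2 * √(ε * Real.log (horizon γ (h.length + 1)) / discN γ h a) := by
  simp only [ucb, divOne, if_neg hN.ne']

theorem le_ucb (hγ : 0 ≤ γ) (hp : p b ≤ 1) (hb : b ∉ failingItems γ ε p h) :
    p b ≤ ucb γ ε h b := by
  rcases (discN_nonneg hγ h b).eq_or_lt with hN | hN
  · simp only [ucb, divOne, if_pos hN.symm, Real.sqrt_one]
    linarith
  · rw [ucb_of_pos hN]
    linarith [(abs_le.1 (abs_sub_le_of_notMem_failingItems hN hb)).1]

theorem sq_gap_mul_discN_le (hγ : 0 ≤ γ) (hγ1 : γ < 1) (hε : 0 ≤ ε) (hp : p b ≤ 1)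
    (ha : a ∉ failingItems γ ε p h) (hb : b ∉ failingItems γ ε p h)
    (hab : ucb γ ε h b ≤ ucb γ ε h a) (hpab : p a ≤ p b) :
    (p b - p a) ^ 2 * discN γ h a ≤ 16 * ε * Real.log (1 / (1 - γ)) := by
  have hlog : Real.log (horizon γ (h.length + 1)) ≤ Real.log (1 / (1 - γ)) :=
    Real.log_le_log (zero_lt_one.trans_le (one_le_horizon_succ hγ hγ1 _)) (horizon_le hγ hγ1 _)
  have hlog0 := Real.log_nonneg (one_le_horizon_succ hγ hγ1 h.length)
  refine le_trans ?_ (mul_le_mul_of_nonneg_left hlog (by positivity))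
  rcases (discN_nonneg hγ h a).eq_or_lt with hN | hN
  · rw [← hN, mul_zero]
    positivity
  · have hradius := (abs_le.1 (abs_sub_le_of_notMem_failingItems hN ha)).2
    have hopt := le_ucb hγ hp hb
    rw [ucb_of_pos hN] at hab
    have hgap : p b - p a ≤ 4 * √(ε * Real.log (horizon γ (h.length + 1)) / discN γ h a) := by
      linarith
    have hsq := pow_le_pow_left₀ (sub_nonneg.2 hpab) hgap 2
    rw [mul_pow, Real.sq_sqrt (by positivity), ← mul_div_assoc, le_div_iff₀ hN] at hsq
    linarith

-- The bias `B - p * N` uses up at most a quarter of the radius, so `X` deviates from its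
-- compensator `B` by at least `3 / 4` of the radius.
theorem le_sq_sub_of_radius_lt {N X B p l ε : ℝ} (hε : 1 / 2 ≤ ε) (hl : 0 ≤ l) (hN : 0 < N)
    (hB : |B - p * N| ≤ N) (hB' : |B - p * N| ≤ ε * l / 4) (hX : 2 * √(ε * l / N) < |X / N - p|) :
    9 / 8 * l * N ≤ (X - B) ^ 2 := by
  set q := √(ε * l * N)
  have : 0 ≤ q := Real.sqrt_nonneg _
  have hq2 : q ^ 2 = ε * l * N := Real.sq_sqrt (by positivity)
  have hdev : 2 * q < |X - p * N| := by
    have hq : √(ε * l / N) * N = q := by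
      rw [← Real.sqrt_sq hN.le, ← Real.sqrt_mul (by positivity), Real.sqrt_sq hN.le]
      congr 1
      field_simp
    have habs : |X / N - p| * N = |X - p * N| := by
      rw [← abs_of_pos hN, ← abs_mul, abs_of_pos hN, sub_mul, div_mul_cancel₀ _ hN.ne']
    linarith [mul_lt_mul_of_pos_right hX hN]
  have hbias : |B - p * N| ≤ q / 2 := by
    refine abs_le.2 (abs_le_of_sq_le_sq' ?_ (by positivity))
    rw [div_pow, hq2, ← sq_abs]
    nlinarith [abs_nonneg (B - p * N)]
  have hmart : 3 / 2 * q ≤ |X - B| := by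
    linarith [abs_sub_le X B (p * N)]
  have hsq := pow_le_pow_left₀ (by positivity) hmart 2
  rw [mul_pow, hq2, sq_abs] at hsq
  nlinarith [mul_nonneg hl hN.le]

variable {Ω : Type u} [MeasurableSpace Ω] {μ : Measure Ω} [IsProbabilityMeasure μ] {n : ℕ}
  {α : ℕ → Fin L → ℝ} {A : ℕ → Ω → Fin L → Bool}

theorem IsEnvironment.integral_indicator_failingItems_le (hA : IsEnvironment μ n α A)
    (π : History L K → RankedList L K) (hγ : 99 / 100 ≤ γ) (hγ1 : γ < 1) (hε : 1 / 2 ≤ ε) {W : ℕ}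
    (hW : γ ^ W / (1 - γ) ≤ ε / 6) {t : ℕ} (ht : t + 1 ≤ n) (a : Fin L)
    (hrecent : ∀ s ∈ Finset.Icc 1 t, t < s + W → α s a = α (t + 1) a) :
    ∫ ω, (failingItems γ ε (α (t + 1)) (hist π (A · ω) t)).indicator 1 a ∂μ ≤
      4 * (1 / horizon γ (t + 1)) := by
  have hγ0 : 0 ≤ γ := by linarith
  have hhorizon : 0 < horizon γ (t + 1) := zero_lt_one.trans_le (one_le_horizon_succ hγ0 hγ1 t)
  rcases Nat.eq_zero_or_pos t with rfl | htpos
  · simp only [hist, failingItems, discN, lt_irrefl, false_and, Set.ofPred_false,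
      Set.indicator_empty, integral_zero]
    positivity
  have hl := two_thirds_le_log_horizon hγ hγ1 (show 2 ≤ t + 1 by omega)
  let E : Set (History L K) := {h | h.length = t ∧ a ∈ failingItems γ ε (α (t + 1)) h}
  have hE : ∀ ω, (failingItems γ ε (α (t + 1)) (hist π (A · ω) t)).indicator (1 : Fin L → ℝ) a =
      E.indicator 1 (hist π (A · ω) t) := fun ω => by
    classical
    have hmem : a ∈ failingItems γ ε (α (t + 1)) (hist π (A · ω) t) ↔ hist π (A · ω) t ∈ E :=
      ⟨fun ha => ⟨length_hist .., ha⟩, And.right⟩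
    simp only [Set.indicator_apply, hmem, Pi.one_apply]
  simp_rw [hE]
  rw [one_div, ← Real.exp_log (inv_pos.2 hhorizon), Real.log_inv]
  refine hA.integral_indicator_deviation_le π hγ0 hγ1 a (by omega) hl ?_ ?_
  · rw [Real.exp_log hhorizon, horizon_succ hγ1.ne]
    have hle := horizon_le hγ0 hγ1 t
    rw [le_div_iff₀ (sub_pos.2 hγ1)] at hle
    linarith
  · rintro h ⟨rfl, hN, hX⟩
    have hα : ∀ s ∈ Finset.Icc 1 h.length, α s a ∈ Set.Icc 0 1 := fun s hs =>
      hA.mem_Icc (Finset.Icc_subset_Icc_right (by omega) hs) a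
    have hp : α (h.length + 1) a ∈ Set.Icc 0 1 :=
      hA.mem_Icc (Finset.mem_Icc.2 ⟨Nat.succ_pos _, ht⟩) a
    refine ⟨hN, le_sq_sub_of_radius_lt hε (by linarith) hN (abs_discMean_sub_le hγ0 h a hp hα)
      ((abs_discMean_sub_le_pow hγ0 hγ1 W h a hp hα hrecent).trans (hW.trans ?_)) hX⟩
    nlinarith

end ConfidenceRadius

section StepRegret

variable {L K : ℕ} {γ ε : ℝ} {p : Fin L → ℝ} {e : RankedList L K}

theorem sum_mul_examProb_le_bernExp (hp : ∀ a, p a ∈ Set.Icc 0 1) (R : RankedList L K)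
    (D : Finset (Fin L)) {ψ : Fin L → ℝ} (hψ : ∀ a, 0 ≤ ψ a) :
    ∑ i with R i ∉ D, ψ (R i) * examProb p R i ≤
      bernExp p fun v => ∑ a ∈ Dᶜ, examInd R (click R v) a * ψ a := calc
  ∑ i with R i ∉ D, ψ (R i) * examProb p R i
    = bernExp p fun v => ∑ i with R i ∉ D, ψ (R i) * examInd R (click R v) (R i) := by
      simp only [bernExp_sum, bernExp_const_mul, bernExp_examInd]
  _ ≤ bernExp p fun v => ∑ a ∈ Dᶜ, examInd R (click R v) a * ψ a := bernExp_mono hp fun v => by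
      simp only [mul_comm (ψ _)]
      exact sum_filter_notMem_le_sum_compl R D (f := fun a => examInd R (click R v) a * ψ a)
        fun a => mul_nonneg (examInd_nonneg ..) (hψ a)

theorem IsCascadeDUCB.reward_sub_reward_le {π : History L K → RankedList L K}
    (hπ : IsCascadeDUCB γ ε π) (hKL : K ≤ L) (hγ : 0 < γ) (hγ1 : γ < 1) (hε : 0 < ε)
    (hp : ∀ a, p a ∈ Set.Icc 0 1) (he : IsTopK K p (Finset.univ.map e))
    (hanti : Antitone fun k => p (e k)) {Δ : Fin L → ℝ}
    (hΔ : ∀ a ∉ Finset.univ.map e, ∀ b ∈ Finset.univ.map e, Δ a ≤ p b - p a) (h : History L K) :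
    reward e p - reward (π h) p ≤
      bernExp p (fun v => ∑ a ∈ (Finset.univ.map e)ᶜ, examInd (π h) (click (π h) v) a *
        cutCap (16 * ε * Real.log (1 / (1 - γ))) (Δ a) (discN γ h a)) +
        ∑ a ∈ (Finset.univ.map e)ᶜ, (failingItems γ ε p h).indicator 1 a +
        (L - K) * ∑ k, (failingItems γ ε p h).indicator 1 (e k) * (p (e k) * examProb p e k) := by
  have hY : 0 < 16 * ε * Real.log (1 / (1 - γ)) :=
    mul_pos (by positivity) (Real.log_pos ((one_lt_div (sub_pos.2 hγ1)).2 (by linarith)))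
  refine (CascadeBandit.reward_sub_reward_le (F := failingItems γ ε p h) hKL hp he hanti
    (fun a => cutCap_nonneg _ (Δ a) (discN γ h a)) ?_).trans (by
      gcongr
      exact sum_mul_examProb_le_bernExp hp (π h) _ fun a => cutCap_nonneg ..)
  intro i k hi hiF hk hkF
  have hpik : p (π h i) ≤ p (e k) := he.2 (e k) (by simp) _ hi
  have hucb : ucb γ ε h (e k) ≤ ucb γ ε h (π h i) := (hπ h).2 _ (by simp) _ (by simpa using hk)
  exact le_cutCap hY (hΔ _ hi _ (by simp))
    ⟨sub_nonneg.2 hpik, by linarith [(hp (e k)).2, (hp (π h i)).1]⟩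
    (sq_gap_mul_discN_le hγ.le hγ1 hε.le (hp (e k)).2 hiF hkF hucb hpik)

variable {Ω : Type u} [MeasurableSpace Ω] {μ : Measure Ω} {n : ℕ} {α : ℕ → Fin L → ℝ}
  {A : ℕ → Ω → Fin L → Bool}

/-- The expected regret of step `t`: the summand of `regret`. -/
noncomputable def stepRegret (μ : Measure Ω) (α : ℕ → Fin L → ℝ) (A : ℕ → Ω → Fin L → Bool)
    (π : History L K → RankedList L K) (t : ℕ) : ℝ :=
  ∫ ω, ((⨆ R : RankedList L K, reward R (α t)) -
    reward (shown π (A · ω) t) (toReal (A t ω))) ∂μ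

theorem IsEnvironment.stepRegret_le [IsProbabilityMeasure μ] (hA : IsEnvironment μ n α A)
    (π : History L K → RankedList L K) {t : ℕ} (ht : t + 1 ≤ n)
    (he : IsTopK K (α (t + 1)) (Finset.univ.map e)) :
    stepRegret μ α A π (t + 1) ≤
      ∫ ω, (reward e (α (t + 1)) - reward (π (hist π (A · ω) t)) (α (t + 1))) ∂μ := by
  set m := ⨆ R : RankedList L K, reward R (α (t + 1))
  have hsup : m ≤ reward e (α (t + 1)) :=
    iSup_reward_le (fun a => (hA.mem_Icc (Finset.mem_Icc.2 ⟨t.succ_pos, ht⟩) a).2) he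
  have hmean : ∀ h, bernExp (α (t + 1)) (fun v => m - reward (π h) (toReal v)) =
      m - reward (π h) (α (t + 1)) := fun h => by
    simp only [sub_eq_add_neg, neg_eq_neg_one_mul (reward _ _), bernExp_add, bernExp_const,
      bernExp_const_mul, bernExp_reward]
  calc stepRegret μ α A π (t + 1)
      = ∫ ω, (m - reward (π (hist π (A · ω) t)) (α (t + 1))) ∂μ := by
        simp only [← hmean]
        exact hA.integral_step π ht fun h v => m - reward (π h) (toReal v)
    _ ≤ _ := integral_mono
        (hA.integrable_hist π (by omega) fun h => m - reward (π h) (α (t + 1)))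
        (hA.integrable_hist π (by omega) fun h => reward e (α (t + 1)) - reward (π h) (α (t + 1)))
        fun ω => sub_le_sub_right hsup _

theorem integral_sum_compl_add_sum_le (hKL : K ≤ L) (hp : ∀ a, p a ∈ Set.Icc 0 1)
    (e : RankedList L K) {f : Fin L → Ω → ℝ} (hf : ∀ a, Integrable (f a) μ) {q : ℝ} (hq0 : 0 ≤ q)
    (hq : ∀ a, ∫ ω, f a ω ∂μ ≤ q) :
    ∫ ω, (∑ a ∈ (Finset.univ.map e)ᶜ, f a ω +
      (L - K) * ∑ k, f (e k) ω * (p (e k) * examProb p e k)) ∂μ ≤ 2 * (L - K) * q := by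
  have hLK : (0 : ℝ) ≤ L - K := sub_nonneg.2 (by exact_mod_cast hKL)
  have hcompl : ∑ a ∈ (Finset.univ.map e)ᶜ, ∫ ω, f a ω ∂μ ≤ (L - K) * q := by
    refine (Finset.sum_le_card_nsmul _ _ q fun a _ => hq a).trans_eq ?_
    rw [Finset.card_compl, Finset.card_map, Finset.card_fin, Fintype.card_fin, nsmul_eq_mul,
      Nat.cast_sub hKL]
  have hmap : ∑ k, ∫ ω, f (e k) ω * (p (e k) * examProb p e k) ∂μ ≤ q := calc
    ∑ k, ∫ ω, f (e k) ω * (p (e k) * examProb p e k) ∂μ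
      ≤ ∑ k, q * (p (e k) * examProb p e k) := Finset.sum_le_sum fun k _ => by
        rw [integral_mul_const]
        exact mul_le_mul_of_nonneg_right (hq (e k))
          (mul_nonneg (hp _).1 (examProb_nonneg (fun a => (hp a).2) e k))
    _ ≤ q := by
      rw [← Finset.mul_sum]
      exact mul_le_of_le_one_right hq0 (sum_mul_examProb_le_one (fun a => (hp a).2) e)
  rw [integral_add (integrable_finsetSum _ fun a _ => hf a)
      ((integrable_finsetSum _ fun k _ => (hf (e k)).mul_const _).const_mul _),
    integral_const_mul, integral_finsetSum _ fun a _ => hf a,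
    integral_finsetSum _ fun k _ => (hf (e k)).mul_const _]
  linarith [mul_le_mul_of_nonneg_left hmap hLK]

variable [IsProbabilityMeasure μ]

theorem IsEnvironment.stepRegret_le_integral_sum_examAt (hKL : K ≤ L) (hA : IsEnvironment μ n α A)
    {π : History L K → RankedList L K} (hγ : 0 < γ) (hγ1 : γ < 1) (hε : 0 < ε)
    (hπ : IsCascadeDUCB γ ε π) {t : ℕ} (ht : t + 1 ≤ n) {D : Finset (Fin L)}
    (hD : IsTopK K (α (t + 1)) D) {Δ : Fin L → ℝ}
    (hΔ : ∀ a ∉ D, ∀ b ∈ D, Δ a ≤ α (t + 1) b - α (t + 1) a) {q : ℝ} (hq0 : 0 ≤ q)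
    (hq : ∀ a, ∫ ω, (failingItems γ ε (α (t + 1)) (hist π (A · ω) t)).indicator 1 a ∂μ ≤ q) :
    stepRegret μ α A π (t + 1) ≤
      ∫ ω, ∑ a ∈ Dᶜ, examAt π (A · ω) (t + 1) a *
        cutCap (16 * ε * Real.log (1 / (1 - γ))) (Δ a) (discN γ (hist π (A · ω) t) a) ∂μ +
        2 * ((L : ℝ) - K) * q := by
  have hp : ∀ a, α (t + 1) a ∈ Set.Icc 0 1 :=
    hA.mem_Icc (Finset.mem_Icc.2 ⟨t.succ_pos, ht⟩)
  obtain ⟨e, rfl, hanti⟩ := exists_antitone_enum (α (t + 1)) hD.1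
  let G : History L K → (Fin L → Bool) → ℝ := fun h v =>
    ∑ a ∈ (Finset.univ.map e)ᶜ, examInd (π h) (click (π h) v) a *
      cutCap (16 * ε * Real.log (1 / (1 - γ))) (Δ a) (discN γ h a)
  let f : Fin L → History L K → ℝ := fun a h => (failingItems γ ε (α (t + 1)) h).indicator 1 a
  let E : History L K → ℝ := fun h => ∑ a ∈ (Finset.univ.map e)ᶜ, f a h +
    (L - K) * ∑ k, f (e k) h * (α (t + 1) (e k) * examProb (α (t + 1)) e k)
  have hint : ∀ F : History L K → ℝ, Integrable (fun ω => F (hist π (A · ω) t)) μ :=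
    hA.integrable_hist π (by omega)
  calc stepRegret μ α A π (t + 1)
      ≤ ∫ ω, (reward e (α (t + 1)) - reward (π (hist π (A · ω) t)) (α (t + 1))) ∂μ :=
        hA.stepRegret_le π ht hD
    _ ≤ ∫ ω, (bernExp (α (t + 1)) (G (hist π (A · ω) t)) + E (hist π (A · ω) t)) ∂μ :=
        integral_mono (hint fun h => reward e (α (t + 1)) - reward (π h) (α (t + 1)))
          (hint fun h => bernExp (α (t + 1)) (G h) + E h) fun ω =>
          (hπ.reward_sub_reward_le hKL hγ hγ1 hε hp hD hanti hΔ _).trans_eq (add_assoc ..)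
    _ = ∫ ω, G (hist π (A · ω) t) (A (t + 1) ω) ∂μ + ∫ ω, E (hist π (A · ω) t) ∂μ := by
        rw [integral_add (hint fun h => bernExp (α (t + 1)) (G h)) (hint E),
          hA.integral_step π ht G]
    _ ≤ _ := add_le_add le_rfl
        (integral_sum_compl_add_sum_le hKL hp e (fun a => hint (f a)) hq0 hq)

end StepRegret

section AfterBreak

variable {L : ℕ} {α : ℕ → Fin L → ℝ} {n W t : ℕ}

open Classical in
/-- The steps `1 ≤ t ≤ n` at distance less than `W` after a breakpoint; outside them `α` has been
constant for `W` steps. -/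
noncomputable def afterBreak (α : ℕ → Fin L → ℝ) (n W : ℕ) : Finset ℕ :=
  (Finset.Icc 1 n).filter fun t => ∃ s ∈ Finset.Icc 2 n, α s ≠ α (s - 1) ∧ s ≤ t ∧ t < s + W

theorem mem_afterBreak : t ∈ afterBreak α n W ↔
    t ∈ Finset.Icc 1 n ∧ ∃ s ∈ Finset.Icc 2 n, α s ≠ α (s - 1) ∧ s ≤ t ∧ t < s + W := by
  simp only [afterBreak, Finset.mem_filter]

theorem card_afterBreak_le (α : ℕ → Fin L → ℝ) (n W : ℕ) :
    (afterBreak α n W).card ≤ numBreaks α n * W := by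
  classical
  let breaks := (Finset.Icc 2 n).filter fun t => α t ≠ α (t - 1)
  have hsub : afterBreak α n W ⊆ breaks.biUnion fun s => Finset.Ico s (s + W) := fun t ht => by
    obtain ⟨-, s, hs, hne, hst, htW⟩ := mem_afterBreak.1 ht
    exact Finset.mem_biUnion.2 ⟨s, Finset.mem_filter.2 ⟨hs, hne⟩, Finset.mem_Ico.2 ⟨hst, htW⟩⟩
  calc (afterBreak α n W).card
      ≤ breaks.card * W := (Finset.card_le_card hsub).trans
        (Finset.card_biUnion_le_card_mul _ _ W fun s _ => by simp)
    _ = numBreaks α n * W := by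
      unfold numBreaks
      congr!

theorem eq_of_notMem_afterBreak (ht : t + 1 ≤ n) (h : t + 1 ∉ afterBreak α n W) {s : ℕ}
    (hs : s ∈ Finset.Icc 1 t) (hW : t < s + W) : α s = α (t + 1) := by
  have hs' := Finset.mem_Icc.1 hs
  suffices ∀ r, s ≤ r → r ≤ t + 1 → α s = α r from this _ (by omega) le_rfl
  intro r hsr
  induction r, hsr using Nat.le_induction with
  | base => exact fun _ => rfl
  | succ r hsr ih =>
    intro hr
    rw [ih (by omega)]
    by_contra hne
    exact h (mem_afterBreak.2 ⟨Finset.mem_Icc.2 (by omega), r + 1, Finset.mem_Icc.2 (by omega),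
      Ne.symm hne, hr, by omega⟩)

end AfterBreak

section DiscountFactor

variable {γ ε x : ℝ}

theorem rpow_one_div_le_exp_neg_one (hγ : 0 < γ) (hγ1 : γ < 1) :
    γ ^ (1 / (1 - γ)) ≤ Real.exp (-1) := by
  rw [Real.rpow_def_of_pos hγ, Real.exp_le_exp, mul_one_div, div_le_iff₀ (sub_pos.2 hγ1)]
  linarith [Real.log_le_sub_one_of_pos hγ]

theorem pow_floor_div_le (hγ : 99 / 100 ≤ γ) (hγ1 : γ < 1) (hε : 0 < ε) (hε1 : ε < 1) :
    γ ^ ⌊2 * (Real.log ((1 - γ) * ε) / Real.log γ)⌋₊ / (1 - γ) ≤ ε / 6 := by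
  have hx : 0 < 1 - γ := sub_pos.2 hγ1
  have hγ0 : 0 < γ := by linarith
  have hxε : (1 - γ) * ε ≤ 1 / 100 * 1 := by gcongr; linarith
  set d := Real.log ((1 - γ) * ε) / Real.log γ with hd
  have hpow_d : γ ^ d = (1 - γ) * ε := by
    rw [Real.rpow_def_of_pos hγ0, hd, mul_div_cancel₀ _ (Real.log_neg hγ0 hγ1).ne,
      Real.exp_log (by positivity)]
  have hfloor : γ ^ ⌊2 * d⌋₊ ≤ ((1 - γ) * ε) ^ 2 / γ := calc
    γ ^ ⌊2 * d⌋₊ ≤ γ ^ (2 * d - 1) := by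
      rw [← Real.rpow_natCast]
      exact Real.rpow_le_rpow_of_exponent_ge hγ0 hγ1.le
        (by linarith [Nat.lt_floor_add_one (2 * d)])
    _ = ((1 - γ) * ε) ^ 2 / γ := by
      rw [Real.rpow_sub_one hγ0.ne', mul_comm, Real.rpow_mul hγ0.le, hpow_d, Real.rpow_two]
  have hsmall : ((1 - γ) * ε) * ((1 - γ) * ε) ≤ γ / 6 * ((1 - γ) * ε) := by
    gcongr
    linarith
  rw [div_le_iff₀ hx]
  refine hfloor.trans ((div_le_iff₀ hγ0).2 ?_)
  linarith

theorem sum_one_div_add_le (hx : 0 < x) (hx1 : x < 1) {n : ℕ} (hn : 1 ≤ n) :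
    ∑ t ∈ Finset.Icc 1 n, (1 / (t : ℝ) + x) ≤ ⌈n * x⌉₊ * (Real.log (1 / x) + 2) := by
  have hn0 : (0 : ℝ) < n := by exact_mod_cast hn
  have hharmonic : ∑ t ∈ Finset.Icc 1 n, 1 / (t : ℝ) ≤ 1 + Real.log n := by
    simpa [harmonic_eq_sum_Icc] using harmonic_le_one_add_log n
  have hlog_n : Real.log n ≤ n * x - 1 + Real.log (1 / x) := by
    have hlog := Real.log_le_sub_one_of_pos (mul_pos hn0 hx)
    rw [Real.log_mul hn0.ne' hx.ne'] at hlog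
    rw [one_div, Real.log_inv]
    linarith
  have hlog : 0 < Real.log (1 / x) := Real.log_pos ((one_lt_div hx).2 hx1)
  have hceil : n * x ≤ ⌈n * x⌉₊ := Nat.le_ceil _
  have hceil1 : (1 : ℝ) ≤ ⌈n * x⌉₊ := by
    exact_mod_cast Nat.one_le_ceil_iff.2 (mul_pos hn0 hx)
  rw [Finset.sum_add_distrib, Finset.sum_const, Nat.card_Icc, Nat.add_sub_cancel, nsmul_eq_mul]
  nlinarith

theorem one_le_mul_log_one_div (hx : 1 / 100 ≤ x) (hx1 : x ≤ 1 / 2) :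
    1 ≤ 43 * x * Real.log (1 / x) := by
  have hx0 : 0 < x := by linarith
  have hlog2 := Real.log_two_gt_d9
  have hlog : ∀ k : ℕ, 2 ^ k * x ≤ 1 → k * Real.log 2 ≤ Real.log (1 / x) := fun k hk => by
    rw [← Real.log_pow]
    exact Real.log_le_log (by positivity) ((le_div_iff₀ hx0).2 hk)
  rcases le_total x (1 / 16) with h | h
  · have hlog4 := hlog 4 (by linarith)
    push_cast at hlog4
    nlinarith
  · have hlog1 := hlog 1 (by linarith)
    push_cast at hlog1
    nlinarith

end DiscountFactor

section Regret

variable {L K : ℕ} {Ω : Type u} [MeasurableSpace Ω] {μ : Measure Ω} [IsProbabilityMeasure μ] {n : ℕ}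
  {α : ℕ → Fin L → ℝ} {A : ℕ → Ω → Fin L → Bool} {γ ε : ℝ} {D : ℕ → Finset (Fin L)}

theorem exists_eq_add_one_of_mem_Icc {t : ℕ} (ht : t ∈ Finset.Icc 1 n) :
    ∃ s, t = s + 1 ∧ s + 1 ≤ n := by
  obtain ⟨h1, hn⟩ := Finset.mem_Icc.1 ht
  exact ⟨t - 1, by omega, by omega⟩

theorem IsEnvironment.stepRegret_le_of_forall_le (hA : IsEnvironment μ n α A)
    (π : History L K → RankedList L K) {t : ℕ} (ht : t ∈ Finset.Icc 1 n) {e : RankedList L K}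
    (he : IsTopK K (α t) (Finset.univ.map e)) {c : ℝ}
    (hc : ∀ h, reward e (α t) - reward (π h) (α t) ≤ c) : stepRegret μ α A π t ≤ c := by
  obtain ⟨s, rfl, hs⟩ := exists_eq_add_one_of_mem_Icc ht
  refine (hA.stepRegret_le π hs he).trans ((integral_mono (hA.integrable_hist π (by omega) fun h =>
    reward e (α (s + 1)) - reward (π h) (α (s + 1))) (integrable_const c) fun ω => hc _).trans ?_)
  simp

theorem IsEnvironment.stepRegret_le_one (hA : IsEnvironment μ n α A)
    (π : History L K → RankedList L K) {t : ℕ} (ht : t ∈ Finset.Icc 1 n)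
    (hD : IsTopK K (α t) (D t)) : stepRegret μ α A π t ≤ 1 := by
  have hp := hA.mem_Icc ht
  obtain ⟨e, he, -⟩ := exists_antitone_enum (α t) hD.1
  refine hA.stepRegret_le_of_forall_le π ht (he.symm ▸ hD) fun h => ?_
  have hle : ∏ i, (1 - α t (π h i)) ≤ 1 :=
    Finset.prod_le_one (fun i _ => sub_nonneg.2 (hp _).2) fun i _ => sub_le_self _ (hp _).1
  have hnonneg : 0 ≤ ∏ i, (1 - α t (e i)) := Finset.prod_nonneg fun i _ => sub_nonneg.2 (hp _).2
  rw [reward, reward]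
  linarith

theorem IsEnvironment.regret_nonpos (hA : IsEnvironment μ n α A)
    (π : History L K → RankedList L K) (hD : ∀ t ∈ Finset.Icc 1 n, IsTopK K (α t) (D t))
    (hK : K = 0 ∨ K = L) : regret μ α A π n ≤ 0 := by
  refine Finset.sum_nonpos fun t ht => ?_
  obtain ⟨e, he, -⟩ := exists_antitone_enum (α t) (hD t ht).1
  refine hA.stepRegret_le_of_forall_le π ht (he.symm ▸ hD t ht) fun h => ?_
  have hmap : Finset.univ.map e = Finset.univ.map (π h) := by
    rcases hK with rfl | rfl
    · simp
    · have huniv : ∀ d : RankedList K K, Finset.univ.map d = Finset.univ := fun d =>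
        (Finset.card_eq_iff_eq_univ _).1 (by simp)
      rw [huniv, huniv]
  rw [reward_eq_of_map_eq hmap, sub_self]

theorem IsEnvironment.regret_le_card (hA : IsEnvironment μ n α A)
    (π : History L K → RankedList L K) (hD : ∀ t ∈ Finset.Icc 1 n, IsTopK K (α t) (D t)) :
    regret μ α A π n ≤ n :=
  (Finset.sum_le_card_nsmul _ _ 1 fun t ht => hA.stepRegret_le_one π ht (hD t ht)).trans (by simp)

/-- The bound, in terms of `cutCap`, for the loss incurred at step `t` by examining the item `a`
although it is suboptimal by at least `Δ`. -/
noncomputable def cappedLoss (γ Y Δ : ℝ) (π : History L K → RankedList L K)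
    (B : ℕ → Fin L → Bool) (t : ℕ) (a : Fin L) : ℝ :=
  examAt π B t a * cutCap Y Δ (discN γ (hist π B (t - 1)) a)

theorem cappedLoss_nonneg (γ Y Δ : ℝ) (π : History L K → RankedList L K) (B : ℕ → Fin L → Bool)
    (t : ℕ) (a : Fin L) : 0 ≤ cappedLoss γ Y Δ π B t a :=
  mul_nonneg (examInd_nonneg ..) (cutCap_nonneg ..)

theorem IsEnvironment.integrable_cappedLoss (hA : IsEnvironment μ n α A) (γ Y Δ : ℝ)
    (π : History L K → RankedList L K) {t : ℕ} (ht : t ∈ Finset.Icc 1 n) (a : Fin L) :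
    Integrable (fun ω => cappedLoss γ Y Δ π (A · ω) t a) μ := by
  obtain ⟨s, rfl, hs⟩ := exists_eq_add_one_of_mem_Icc ht
  refine hA.integrable_of_dependsOn (F := fun B => cappedLoss γ Y Δ π B (s + 1) a) fun B B' h => ?_
  have hhist : hist π B s = hist π B' s :=
    dependsOn_hist π s fun r hr => h r ⟨hr.1, hr.2.trans (by omega)⟩
  simp only [cappedLoss, examAt, shown, Nat.add_sub_cancel, hhist, h (s + 1) ⟨by omega, hs⟩]

theorem IsEnvironment.sum_integral_cappedLoss_le (hA : IsEnvironment μ n α A)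
    (π : History L K → RankedList L K) (hγ : 0 < γ) (hγ1 : γ < 1) {Y Δ : ℝ} (hY : 0 < Y)
    (hΔ : Δ ∈ Set.Ioc 0 1) (a : Fin L) :
    ∑ t ∈ Finset.Icc 1 n, ∫ ω, cappedLoss γ Y Δ π (A · ω) t a ∂μ ≤
      ⌈n * (1 - γ)⌉₊ * (2 * (Y / γ ^ (1 / (1 - γ))) / Δ - Y / γ ^ (1 / (1 - γ)) + 2) := by
  have hint : ∀ t ∈ Finset.Icc 1 n, Integrable (fun ω => cappedLoss γ Y Δ π (A · ω) t a) μ :=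
    fun t ht => hA.integrable_cappedLoss γ Y Δ π ht a
  rw [← integral_finsetSum _ hint]
  refine (integral_mono (integrable_finsetSum _ hint) (integrable_const _) fun ω =>
    sum_examAt_cutCap_le π (A · ω) hγ hγ1 n a hY hΔ.1 hΔ.2).trans ?_
  simp

theorem IsEnvironment.stepRegret_le_of_notMem_afterBreak (hKL : K ≤ L) (hA : IsEnvironment μ n α A)
    {π : History L K → RankedList L K} (hγ : 99 / 100 ≤ γ) (hγ1 : γ < 1) (hε : 1 / 2 ≤ ε)
    (hπ : IsCascadeDUCB γ ε π) {W : ℕ} (hW : γ ^ W / (1 - γ) ≤ ε / 6) {t : ℕ}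
    (ht : t ∈ Finset.Icc 1 n) (htW : t ∉ afterBreak α n W) (hD : IsTopK K (α t) (D t))
    {Δ : Fin L → ℝ} (hΔ : ∀ a ∉ D t, ∀ b ∈ D t, Δ a ≤ α t b - α t a) :
    stepRegret μ α A π t ≤
      ∑ a ∈ (D t)ᶜ, ∫ ω, cappedLoss γ (16 * ε * Real.log (1 / (1 - γ))) (Δ a) π (A · ω) t a ∂μ +
        8 * (L - K) * (1 / t + (1 - γ)) := by
  have hγ0 : 0 ≤ γ := by linarith
  have hLK : (0 : ℝ) ≤ L - K := sub_nonneg.2 (by exact_mod_cast hKL)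
  rw [← integral_finsetSum _ fun a _ => hA.integrable_cappedLoss γ _ (Δ a) π ht a]
  obtain ⟨s, rfl, hs⟩ := exists_eq_add_one_of_mem_Icc ht
  have hhorizon := one_le_horizon_succ hγ0 hγ1 s
  have hfail := fun a => hA.integral_indicator_failingItems_le π hγ hγ1 hε hW hs a
    fun r hr hrW => congrFun (eq_of_notMem_afterBreak hs htW hr hrW) a
  refine (hA.stepRegret_le_integral_sum_examAt hKL (by linarith) hγ1 (by linarith) hπ hs hD hΔ
    (by positivity) hfail).trans (add_le_add le_rfl ?_)
  linarith [mul_le_mul_of_nonneg_left (one_div_horizon_le hγ0 hγ1 s.succ_pos) hLK]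

theorem IsEnvironment.stepRegret_le_ite_add (hKL : K ≤ L) (hA : IsEnvironment μ n α A)
    {π : History L K → RankedList L K} (hγ : 99 / 100 ≤ γ) (hγ1 : γ < 1) (hε : 1 / 2 ≤ ε)
    (hπ : IsCascadeDUCB γ ε π) {W : ℕ} (hW : γ ^ W / (1 - γ) ≤ ε / 6) {t : ℕ}
    (ht : t ∈ Finset.Icc 1 n) (hD : IsTopK K (α t) (D t)) {F : Finset (Fin L)}
    (hF : ∀ a ∉ D t, a ∈ F) {Δ : Fin L → ℝ}
    (hΔ : ∀ a ∉ D t, ∀ b ∈ D t, Δ a ≤ α t b - α t a) :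
    stepRegret μ α A π t ≤ (if t ∈ afterBreak α n W then 1 else 0) +
      (∑ a ∈ F, ∫ ω, cappedLoss γ (16 * ε * Real.log (1 / (1 - γ))) (Δ a) π (A · ω) t a ∂μ +
        8 * (L - K) * (1 / t + (1 - γ))) := by
  have hnonneg : ∀ a, 0 ≤
      ∫ ω, cappedLoss γ (16 * ε * Real.log (1 / (1 - γ))) (Δ a) π (A · ω) t a ∂μ :=
    fun a => integral_nonneg fun ω => cappedLoss_nonneg ..
  split_ifs with htW
  · have hrest : (0 : ℝ) ≤ 8 * (L - K) * (1 / t + (1 - γ)) := by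
      have hLK : (0 : ℝ) ≤ L - K := sub_nonneg.2 (by exact_mod_cast hKL)
      have : 0 ≤ 1 - γ := sub_nonneg.2 hγ1.le
      positivity
    linarith [hA.stepRegret_le_one π ht hD, Finset.sum_nonneg fun a (_ : a ∈ F) => hnonneg a]
  · rw [zero_add]
    refine (hA.stepRegret_le_of_notMem_afterBreak hKL hγ hγ1 hε hπ hW ht htW hD hΔ).trans
      (add_le_add ?_ le_rfl)
    exact Finset.sum_le_sum_of_subset_of_nonneg (fun a ha => hF a (by simpa using ha))
      fun a _ _ => hnonneg a

-- The term `-m * y` left over in each capped sum absorbs the cost of the radius failures.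
theorem sum_capped_add_le {ι : Type*} (F : Finset ι) (z : ι → ℝ) {m k l y : ℝ} (hm : 0 ≤ m)
    (hkF : k ≤ F.card) (hl : 2 ≤ l) (hy : 21 * l ≤ y) :
    ∑ a ∈ F, m * (z a - y + 2) + 8 * k * (m * (l + 2)) ≤ ∑ a ∈ F, z a * m := by
  have hterm : m * (8 * (l + 2)) ≤ m * (y - 2) := mul_le_mul_of_nonneg_left (by linarith) hm
  have hfail : k * (m * (8 * (l + 2))) ≤ F.card * (m * (y - 2)) :=
    mul_le_mul hkF hterm (by positivity) (by positivity)
  have hsum : ∑ a ∈ F, m * (z a - y + 2) = ∑ a ∈ F, z a * m - F.card * (m * (y - 2)) := by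
    rw [← nsmul_eq_mul, ← Finset.sum_const, ← Finset.sum_sub_distrib]
    exact Finset.sum_congr rfl fun a _ => by ring
  linarith

theorem two_le_log_one_div {x : ℝ} (hx : 0 < x) (hx1 : x ≤ 1 / 100) : 2 ≤ Real.log (1 / x) := by
  rw [Real.le_log_iff_exp_le (by positivity), le_div_iff₀ hx]
  have hexp : Real.exp 2 ≤ 3 ^ 2 := by
    rw [← Real.exp_one_rpow, Real.rpow_two]
    gcongr
    exact Real.exp_one_lt_three.le
  nlinarith

theorem IsTopK.sub_le_card_of_forall_notMem (hKL : K ≤ L) {u : Fin L → ℝ} {S F : Finset (Fin L)}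
    (hS : IsTopK K u S) (hF : ∀ a ∉ S, a ∈ F) : (L : ℝ) - K ≤ F.card := by
  have hcard : Sᶜ.card ≤ F.card := Finset.card_le_card fun a ha => hF a (by simpa using ha)
  rw [Finset.card_compl, hS.1, Fintype.card_fin] at hcard
  rw [← Nat.cast_sub hKL]
  exact_mod_cast hcard

theorem IsEnvironment.regret_le_of_window (hKL : K ≤ L) (hA : IsEnvironment μ n α A)
    {π : History L K → RankedList L K} (hγ : 99 / 100 ≤ γ) (hγ1 : γ < 1) (hε : 1 / 2 < ε)
    (hπ : IsCascadeDUCB γ ε π) (hD : ∀ t ∈ Finset.Icc 1 n, IsTopK K (α t) (D t)) (hn : 1 ≤ n)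
    {W : ℕ} (hW : γ ^ W / (1 - γ) ≤ ε / 6) {F : Finset (Fin L)} {Δ : Fin L → ℝ}
    (hF : ∀ t ∈ Finset.Icc 1 n, ∀ a ∉ D t, a ∈ F) (hΔ01 : ∀ a ∈ F, Δ a ∈ Set.Ioc 0 1)
    (hΔ : ∀ t ∈ Finset.Icc 1 n, ∀ a ∉ D t, ∀ b ∈ D t, Δ a ≤ α t b - α t a) :
    regret μ α A π n ≤ numBreaks α n * W + ∑ a ∈ F, 32 * ε / (Δ a * γ ^ (1 / (1 - γ))) *
      ⌈n * (1 - γ)⌉₊ * Real.log (1 / (1 - γ)) := by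
  have hγ0 : 0 < γ := by linarith
  have hx : 0 < 1 - γ := sub_pos.2 hγ1
  have hl := two_le_log_one_div hx (by linarith)
  have hLK : (0 : ℝ) ≤ L - K := sub_nonneg.2 (by exact_mod_cast hKL)
  have hn1 : 1 ∈ Finset.Icc 1 n := Finset.left_mem_Icc.2 hn
  have hLKF := (hD 1 hn1).sub_le_card_of_forall_notMem hKL (hF 1 hn1)
  set l := Real.log (1 / (1 - γ))
  set c := γ ^ (1 / (1 - γ))
  set m : ℝ := ((⌈(n : ℝ) * (1 - γ)⌉₊ : ℕ) : ℝ)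
  have hY : 0 < 16 * ε * l := by positivity
  have hc : 0 < c := by positivity
  have hYc : 21 * l ≤ 16 * ε * l / c := by
    rw [le_div_iff₀ hc]
    nlinarith [rpow_one_div_le_exp_neg_one hγ0 hγ1, Real.exp_neg_one_lt_d9]
  have hbreaks : ∑ t ∈ Finset.Icc 1 n, (if t ∈ afterBreak α n W then (1 : ℝ) else 0) ≤
      numBreaks α n * W := by
    rw [Finset.sum_ite_mem, Finset.sum_const, nsmul_eq_mul, mul_one]
    exact_mod_cast (Finset.card_le_card Finset.inter_subset_right).trans (card_afterBreak_le α n W)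
  have hsteps := Finset.sum_le_sum fun t ht => hA.stepRegret_le_ite_add hKL hγ hγ1 hε.le hπ hW ht
    (hD t ht) (hF t ht) (hΔ t ht)
  rw [Finset.sum_add_distrib, Finset.sum_add_distrib, Finset.sum_comm, ← Finset.mul_sum] at hsteps
  have hcapped := Finset.sum_le_sum fun a ha =>
    hA.sum_integral_cappedLoss_le π hγ0 hγ1 hY (hΔ01 a ha) a
  have hfail := mul_le_mul_of_nonneg_left (sum_one_div_add_le hx (by linarith) hn)
    (by positivity : 0 ≤ 8 * ((L : ℝ) - K))
  have htotal := sum_capped_add_le F (fun a => 2 * (16 * ε * l / c) / Δ a)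
    (Nat.cast_nonneg _ : 0 ≤ m) hLKF hl hYc
  have hz : ∀ a ∈ F, 2 * (16 * ε * l / c) / Δ a * m = 32 * ε / (Δ a * c) * m * l := fun a ha => by
    have := (hΔ01 a ha).1.ne'
    field_simp
    ring
  rw [Finset.sum_congr rfl hz] at htotal
  change ∑ t ∈ Finset.Icc 1 n, stepRegret μ α A π t ≤ _
  linarith

theorem le_mul_ceil_mul_log_one_div (hγ : 1 / 2 < γ) (hγ1 : γ ≤ 99 / 100) (hε : 1 / 2 < ε) {Δ : ℝ}
    (hΔ : Δ ∈ Set.Ioc 0 1) (n : ℕ) : (n : ℝ) ≤ 32 * ε / (Δ * γ ^ (1 / (1 - γ))) *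
      ⌈n * (1 - γ)⌉₊ * Real.log (1 / (1 - γ)) := by
  have hγ0 : 0 < γ := by linarith
  have hx : 0 < 1 - γ := by linarith
  have hlog : 0 < Real.log (1 / (1 - γ)) := Real.log_pos (by rw [lt_div_iff₀ hx]; linarith)
  have hcoeff : 43 ≤ 32 * ε / (Δ * γ ^ (1 / (1 - γ))) := by
    have hΔ0 := hΔ.1
    have hden : Δ * γ ^ (1 / (1 - γ)) ≤ 1 * (16 / 43) := by
      refine mul_le_mul hΔ.2 ((rpow_one_div_le_exp_neg_one hγ0 (by linarith)).trans ?_)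
        (by positivity) zero_le_one
      linarith [Real.exp_neg_one_lt_d9]
    rw [le_div_iff₀ (by positivity)]
    linarith
  calc (n : ℝ) ≤ n * (43 * (1 - γ) * Real.log (1 / (1 - γ))) :=
        le_mul_of_one_le_right n.cast_nonneg
          (one_le_mul_log_one_div (by linarith) (by linarith))
    _ = 43 * (n * (1 - γ)) * Real.log (1 / (1 - γ)) := by ring
    _ ≤ _ := by
      gcongr
      exact Nat.le_ceil _

theorem IsEnvironment.regret_le (hK : 0 < K) (hKL : K < L) (hA : IsEnvironment μ n α A)
    {π : History L K → RankedList L K} (hγ : 1 / 2 < γ) (hγ1 : γ < 1) (hε : 1 / 2 < ε)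
    (hε1 : ε < 1) (hπ : IsCascadeDUCB γ ε π)
    (hD : ∀ t ∈ Finset.Icc 1 n, IsTopK K (α t) (D t)) {F : Finset (Fin L)} {Δ : Fin L → ℝ}
    (hF : ∀ t ∈ Finset.Icc 1 n, ∀ a ∉ D t, a ∈ F) (hΔ01 : ∀ a ∈ F, Δ a ∈ Set.Ioc 0 1)
    (hΔ : ∀ t ∈ Finset.Icc 1 n, ∀ a ∉ D t, ∀ b ∈ D t, Δ a ≤ α t b - α t a) :
    regret μ α A π n ≤ L * numBreaks α n * (Real.log ((1 - γ) * ε) / Real.log γ) +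
      ∑ a ∈ F, 32 * ε / (Δ a * γ ^ (1 / (1 - γ))) *
        ⌈n * (1 - γ)⌉₊ * Real.log (1 / (1 - γ)) := by
  have hγ0 : 0 < γ := by linarith
  have hx : 0 < 1 - γ := sub_pos.2 hγ1
  have hlog : 0 < Real.log (1 / (1 - γ)) := Real.log_pos (by rw [lt_div_iff₀ hx]; linarith)
  have hd : 0 ≤ Real.log ((1 - γ) * ε) / Real.log γ :=
    div_nonneg_of_nonpos (Real.log_nonpos (by positivity) (by nlinarith))
      (Real.log_nonpos hγ0.le hγ1.le)
  have hterm : ∀ a ∈ F, 0 ≤ 32 * ε / (Δ a * γ ^ (1 / (1 - γ))) *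
      ⌈n * (1 - γ)⌉₊ * Real.log (1 / (1 - γ)) := fun a ha => by
    have := (hΔ01 a ha).1
    positivity
  rcases Nat.eq_zero_or_pos n with rfl | hn
  · rw [regret, Finset.Icc_eq_empty (by omega), Finset.sum_empty]
    exact add_nonneg (by positivity) (Finset.sum_nonneg hterm)
  rcases le_or_gt (99 / 100) γ with hγ' | hγ'
  · refine (hA.regret_le_of_window hKL.le hγ' hγ1 hε hπ hD hn
      (pow_floor_div_le hγ' hγ1 (by linarith) hε1) hF hΔ01 hΔ).trans (add_le_add ?_ le_rfl)
    have hL : (2 : ℝ) ≤ L := by exact_mod_cast (by omega : 2 ≤ L)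
    calc (numBreaks α n : ℝ) * ⌊2 * (Real.log ((1 - γ) * ε) / Real.log γ)⌋₊
        ≤ numBreaks α n * (L * (Real.log ((1 - γ) * ε) / Real.log γ)) := by
          gcongr
          exact (Nat.floor_le (by positivity)).trans (by gcongr)
      _ = _ := by ring
  · have hn1 : 1 ∈ Finset.Icc 1 n := Finset.left_mem_Icc.2 hn
    obtain ⟨a, ha⟩ : ∃ a, a ∉ D 1 := by
      by_contra! hall
      have hcard := (hD 1 hn1).1
      rw [Finset.eq_univ_iff_forall.2 hall, Finset.card_univ, Fintype.card_fin] at hcard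
      omega
    have haF := hF 1 hn1 a ha
    calc regret μ α A π n ≤ n := hA.regret_le_card π hD
      _ ≤ _ := le_mul_ceil_mul_log_one_div hγ hγ'.le hε (hΔ01 a haF) n
      _ ≤ _ := Finset.single_le_sum hterm haF
      _ ≤ _ := le_add_of_nonneg_left (by positivity)

end Regret

section Gap

variable {L K : ℕ} {γ ε : ℝ}

theorem gap_le {α : ℕ → Fin L → ℝ} {D : ℕ → Finset (Fin L)} {n t : ℕ} (ht : t ∈ Finset.Icc 1 n)
    {a b : Fin L} (ha : a ∉ D t) (hb : b ∈ D t) :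
    gap α D n a ≤ ENNReal.ofReal (α t b - α t a) :=
  (iInf₂_le t ht).trans ((iInf_le _ ha).trans (iInf₂_le b hb))

theorem le_sub_of_ofReal_le_gap {α : ℕ → Fin L → ℝ} {D : ℕ → Finset (Fin L)} {n t : ℕ}
    (ht : t ∈ Finset.Icc 1 n) (hD : IsTopK K (α t) (D t)) {a b : Fin L} (ha : a ∉ D t)
    (hb : b ∈ D t) {x : ℝ} (hx : ENNReal.ofReal x ≤ gap α D n a) : x ≤ α t b - α t a :=
  (ENNReal.ofReal_le_ofReal_iff (sub_nonneg.2 (hD.2 b hb a ha))).1 (hx.trans (gap_le ht ha hb))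

theorem constC_mul_eq_top (hε : 0 < ε) (hγ : 0 < γ) (hγ1 : γ < 1) {n : ℕ} (hn : 1 ≤ n) :
    constC ε γ 0 * (⌈n * (1 - γ)⌉₊ : ℝ≥0∞) * ENNReal.ofReal (Real.log (1 / (1 - γ))) = ⊤ := by
  have hx : 0 < 1 - γ := sub_pos.2 hγ1
  have hconst : constC ε γ 0 = ⊤ := by
    rw [constC, zero_mul, ENNReal.div_zero (ENNReal.ofReal_pos.2 (by positivity)).ne', add_top]
  have hceil : (⌈n * (1 - γ)⌉₊ : ℝ≥0∞) ≠ 0 :=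
    Nat.cast_ne_zero.2 (Nat.ceil_pos.2 (by positivity)).ne'
  have hlog : ENNReal.ofReal (Real.log (1 / (1 - γ))) ≠ 0 :=
    (ENNReal.ofReal_pos.2 (Real.log_pos ((one_lt_div hx).2 (by linarith)))).ne'
  rw [hconst, ENNReal.top_mul hceil, ENNReal.top_mul hlog]

theorem ofReal_le_constC_mul {Δ : ℝ} (hγ : 0 < γ) (hε : 0 ≤ ε) (hΔ : 0 < Δ) (m : ℕ) (l : ℝ) :
    ENNReal.ofReal (32 * ε / (Δ * γ ^ (1 / (1 - γ))) * m * l) ≤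
      constC ε γ (ENNReal.ofReal Δ) * m * ENNReal.ofReal l := by
  rw [ENNReal.ofReal_mul (by positivity), ENNReal.ofReal_mul (by positivity),
    ENNReal.ofReal_natCast, ENNReal.ofReal_div_of_pos (by positivity), ENNReal.ofReal_mul hΔ.le]
  gcongr
  exact le_add_self

variable {Ω : Type u} [MeasurableSpace Ω] {μ : Measure Ω} [IsProbabilityMeasure μ] {n : ℕ}
  {α : ℕ → Fin L → ℝ} {A : ℕ → Ω → Fin L → Bool} {D : ℕ → Finset (Fin L)}

theorem IsEnvironment.gap_le_one (hA : IsEnvironment μ n α A) (hK : 0 < K) {t : ℕ}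
    (ht : t ∈ Finset.Icc 1 n) (hD : IsTopK K (α t) (D t)) {a : Fin L} (ha : a ∉ D t) :
    gap α D n a ≤ 1 := by
  obtain ⟨b, hb⟩ : (D t).Nonempty := Finset.card_pos.1 (hD.1.symm ▸ hK)
  refine (gap_le ht ha hb).trans (ENNReal.ofReal_le_one.2 ?_)
  linarith [(hA.mem_Icc ht b).2, (hA.mem_Icc ht a).1]

theorem IsEnvironment.ofReal_regret_le (hKL : K ≤ L) (hA : IsEnvironment μ n α A)
    {π : History L K → RankedList L K} (hγ : 1 / 2 < γ) (hγ1 : γ < 1) (hε : 1 / 2 < ε)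
    (hε1 : ε < 1) (hπ : IsCascadeDUCB γ ε π) (hD : ∀ t ∈ Finset.Icc 1 n, IsTopK K (α t) (D t)) :
    ENNReal.ofReal (regret μ α A π n) ≤
      ENNReal.ofReal (L * numBreaks α n * (Real.log ((1 - γ) * ε) / Real.log γ)) +
        ∑ a : Fin L, constC ε γ (gap α D n a) * (⌈n * (1 - γ)⌉₊ : ℝ≥0∞) *
          ENNReal.ofReal (Real.log (1 / (1 - γ))) := by
  classical
  have hγ0 : 0 < γ := by linarith
  by_cases hK : K = 0 ∨ K = L
  · exact (ENNReal.ofReal_of_nonpos (hA.regret_nonpos π hD hK)).trans_le zero_le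
  obtain ⟨hK0, hKL'⟩ : 0 < K ∧ K < L := by omega
  let F : Finset (Fin L) := {a | ∃ t ∈ Finset.Icc 1 n, a ∉ D t}
  have hmemF : ∀ {a}, a ∈ F ↔ ∃ t ∈ Finset.Icc 1 n, a ∉ D t := by simp [F]
  by_cases hzero : ∃ a ∈ F, gap α D n a = 0
  · obtain ⟨a, ha, ha0⟩ := hzero
    obtain ⟨t, ht, -⟩ := hmemF.1 ha
    have htop := constC_mul_eq_top (ε := ε) (by linarith) hγ0 hγ1
      (n := n) ((Finset.mem_Icc.1 ht).1.trans (Finset.mem_Icc.1 ht).2)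
    rw [ENNReal.sum_eq_top.2 ⟨a, Finset.mem_univ a, by rw [ha0, htop]⟩, add_top]
    exact le_top
  push Not at hzero
  have hgap1 : ∀ a ∈ F, gap α D n a ≤ 1 := fun a ha => by
    obtain ⟨t, ht, hat⟩ := hmemF.1 ha
    exact hA.gap_le_one hK0 ht (hD t ht) hat
  have hgap_top : ∀ a ∈ F, gap α D n a ≠ ⊤ := fun a ha => ne_top_of_le_ne_top (by simp) (hgap1 a ha)
  have hpos : ∀ a ∈ F, 0 < (gap α D n a).toReal := fun a ha =>
    ENNReal.toReal_pos (hzero a ha) (hgap_top a ha)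
  have hreal := hA.regret_le hK0 hKL' hγ hγ1 hε hε1 hπ hD (F := F)
    (Δ := fun a => (gap α D n a).toReal) (fun t ht a ha => hmemF.2 ⟨t, ht, ha⟩)
    (fun a ha => ⟨hpos a ha,
      ENNReal.toReal_le_of_le_ofReal zero_le_one (by simpa using hgap1 a ha)⟩)
    (fun t ht a ha b hb => le_sub_of_ofReal_le_gap ht (hD t ht) ha hb ENNReal.ofReal_toReal_le)
  have hlog : 0 ≤ Real.log (1 / (1 - γ)) :=
    Real.log_nonneg ((one_le_div (sub_pos.2 hγ1)).2 (by linarith))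
  refine (ENNReal.ofReal_le_ofReal hreal).trans (ENNReal.ofReal_add_le.trans ?_)
  rw [ENNReal.ofReal_sum_of_nonneg fun a _ => by positivity]
  refine add_le_add le_rfl ((Finset.sum_le_sum fun a ha => ?_).trans
    (Finset.sum_le_sum_of_subset_of_nonneg (Finset.subset_univ F) fun a _ _ => zero_le))
  simpa only [ENNReal.ofReal_toReal (hgap_top a ha)] using ofReal_le_constC_mul (ε := ε) hγ0
    (by linarith) (hpos a ha) ⌈n * (1 - γ)⌉₊ (Real.log (1 / (1 - γ)))

end Gap

section Tuning

variable {γ ε x Υ : ℝ} {n : ℕ}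

theorem exp_neg_two_le_rpow (hγ : 1 / 2 ≤ γ) (hγ1 : γ < 1) :
    Real.exp (-2) ≤ γ ^ (1 / (1 - γ)) := by
  have hγ0 : 0 < γ := by linarith
  rw [Real.rpow_def_of_pos hγ0, Real.exp_le_exp, mul_one_div, le_div_iff₀ (sub_pos.2 hγ1)]
  have hinv : γ⁻¹ - 1 ≤ 2 * (1 - γ) := by
    rw [inv_eq_one_div, div_sub_one hγ0.ne', div_le_iff₀ hγ0]
    nlinarith
  linarith [Real.one_sub_inv_le_log_of_pos hγ0]

theorem log_one_div_le (hx : 0 < x) (hn : 2 ≤ n) (hnx : 1 ≤ 4 * (n * x)) :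
    Real.log (1 / x) ≤ 3 * Real.log n := by
  have hn2 : (2 : ℝ) ≤ n := by exact_mod_cast hn
  rw [← Real.log_rpow (by linarith)]
  refine Real.log_le_log (by positivity) ((div_le_iff₀ hx).2 (hnx.trans ?_))
  norm_num
  nlinarith [mul_nonneg (show (0 : ℝ) ≤ n ^ 2 - 4 by nlinarith) (show 0 ≤ n * x by positivity)]

theorem log_mul_div_log_one_sub_le (hx : 0 < x) (hx1 : x < 1) (hε : 1 / 2 < ε) (hn : 2 ≤ n)
    (hnx : 1 ≤ 4 * (n * x)) : Real.log (x * ε) / Real.log (1 - x) ≤ 4 * Real.log n / x := by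
  have hlog2 : -Real.log ε ≤ Real.log n := by
    rw [← Real.log_inv]
    refine Real.log_le_log (by positivity) (le_trans ?_ (by exact_mod_cast hn : (2 : ℝ) ≤ n))
    rw [inv_le_comm₀ (by positivity) (by norm_num)]
    linarith
  have hlogx := log_one_div_le hx hn hnx
  rw [one_div, Real.log_inv] at hlogx
  rw [← neg_div_neg_eq, Real.log_mul hx.ne' (by positivity)]
  exact div_le_div₀ (by positivity) (by linarith) hx
    (by linarith [Real.log_le_sub_one_of_pos (sub_pos.2 hx1)])

theorem mul_sqrt_div (hn : 0 < n) (Υ : ℝ) : n * (1 / 4 * √(Υ / n)) = √(n * Υ) / 4 := by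
  have hn0 : (0 : ℝ) < n := by exact_mod_cast hn
  have hsqrt : √(n * Υ) = n * √(Υ / n) := by
    rw [show n * Υ = n ^ 2 * (Υ / n) by field_simp, Real.sqrt_mul (by positivity),
      Real.sqrt_sq hn0.le]
  rw [hsqrt]
  ring

theorem div_sqrt_div (hn : 0 < n) (hΥ : 0 < Υ) : Υ / (1 / 4 * √(Υ / n)) = 4 * √(n * Υ) := by
  have : (0 : ℝ) < n := by exact_mod_cast hn
  have hsqrt : √(n * Υ) * √(Υ / n) = Υ := by
    rw [← Real.sqrt_mul (by positivity), show n * Υ * (Υ / n) = Υ ^ 2 by field_simp,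
      Real.sqrt_sq hΥ.le]
  rw [div_eq_iff (by positivity)]
  linarith

theorem div_mul_rpow_mul_ceil_mul_log_le {Δ : ℝ} (hΔ : 0 < Δ) (hε1 : ε ≤ 1)
    (hx : 0 < x) (hx1 : x ≤ 1 / 2) (hn : 2 ≤ n) (hnx : 1 ≤ 4 * (n * x)) :
    32 * ε / (Δ * (1 - x) ^ (1 / x)) * ⌈n * x⌉₊ * Real.log (1 / x) ≤
      192 * (Real.exp 2 / Δ) * (4 * (n * x)) * Real.log n := by
  have hcoeff : 32 * ε / (Δ * (1 - x) ^ (1 / x)) ≤ 32 * (Real.exp 2 / Δ) := by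
    have hexp := exp_neg_two_le_rpow (γ := 1 - x) (by linarith) (by linarith)
    rw [sub_sub_cancel] at hexp
    calc _ ≤ 32 * 1 / (Δ * Real.exp (-2)) := by gcongr
      _ = _ := by
        rw [Real.exp_neg]
        field_simp
  have hceil : (⌈n * x⌉₊ : ℝ) ≤ 2 * (4 * (n * x)) := by
    linarith [Nat.ceil_lt_add_one (show 0 ≤ n * x by positivity)]
  have hlog : 0 ≤ Real.log (1 / x) := Real.log_nonneg ((one_le_div hx).2 (by linarith))
  calc _ ≤ 32 * (Real.exp 2 / Δ) * (2 * (4 * (n * x))) * (3 * Real.log n) := by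
        gcongr
        exact log_one_div_le hx hn hnx
    _ = _ := by ring

end Tuning

section SqrtBound

variable {L K : ℕ} {Ω : Type u} [MeasurableSpace Ω] {μ : Measure Ω} [IsProbabilityMeasure μ] {n : ℕ}
  {α : ℕ → Fin L → ℝ} {A : ℕ → Ω → Fin L → Bool} {D : ℕ → Finset (Fin L)}

theorem numBreaks_le (α : ℕ → Fin L → ℝ) (n : ℕ) : numBreaks α n ≤ n - 1 :=
  (Finset.card_filter_le _ _).trans (by simp)

theorem IsEnvironment.regret_le_sqrt (hKL : K ≤ L) (hA : IsEnvironment μ n α A)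
    {π : History L K → RankedList L K} {ε δ : ℝ} (hε : 1 / 2 < ε) (hε1 : ε < 1) (hδ : 0 < δ)
    (hD : ∀ t ∈ Finset.Icc 1 n, IsTopK K (α t) (D t))
    (hgap : ∀ a : Fin L, ENNReal.ofReal δ ≤ gap α D n a) (hΥ : 1 ≤ numBreaks α n)
    (hπ : IsCascadeDUCB (1 - 1 / 4 * √((numBreaks α n : ℝ) / n)) ε π) :
    regret μ α A π n ≤ (16 * L + 192 * L * (Real.exp 2 / min δ 1)) *
      √(n * numBreaks α n) * Real.log n := by
  have hδ' : 0 < min δ 1 := lt_min hδ one_pos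
  by_cases hK : K = 0 ∨ K = L
  · exact (hA.regret_nonpos π hD hK).trans (by positivity)
  obtain ⟨hK0, hKL'⟩ : 0 < K ∧ K < L := by omega
  have hΥn := numBreaks_le α n
  have hn2 : 2 ≤ n := by omega
  have hn0 : (0 : ℝ) < n := by exact_mod_cast (by omega : 0 < n)
  have hΥ1 : (1 : ℝ) ≤ numBreaks α n := by exact_mod_cast hΥ
  have hΥn' : (numBreaks α n : ℝ) ≤ n := by exact_mod_cast (by omega : numBreaks α n ≤ n)
  have hnx := mul_sqrt_div (n := n) (by omega) (numBreaks α n)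
  have hΥx := div_sqrt_div (n := n) (by omega) (zero_lt_one.trans_le hΥ1)
  set Υ := (numBreaks α n : ℝ) with hΥdef
  set S := √(n * Υ)
  have hx0 : 0 < 1 / 4 * √(Υ / n) := by positivity
  have hx4 : 1 / 4 * √(Υ / n) ≤ 1 / 4 := by
    linarith [Real.sqrt_le_one.2 ((div_le_one hn0).2 hΥn')]
  set x := 1 / 4 * √(Υ / n)
  have hS : 4 * (n * x) = S := by linarith
  have hS1 : 1 ≤ 4 * (n * x) := by
    rw [hS]
    exact Real.one_le_sqrt.2 (one_le_mul_of_one_le_of_one_le (hΥ1.trans hΥn') hΥ1)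
  have hbreaks : L * Υ * (Real.log (x * ε) / Real.log (1 - x)) ≤ 16 * L * S * Real.log n := calc
    L * Υ * (Real.log (x * ε) / Real.log (1 - x)) ≤ L * Υ * (4 * Real.log n / x) :=
      mul_le_mul_of_nonneg_left
        (log_mul_div_log_one_sub_le hx0 (by linarith) hε hn2 hS1) (by positivity)
    _ = L * (Υ / x) * (4 * Real.log n) := by ring
    _ = 16 * L * S * Real.log n := by rw [hΥx]; ring
  have hitem := div_mul_rpow_mul_ceil_mul_log_le hδ' hε1.le hx0 (by linarith) hn2 hS1
  have hmain := hA.regret_le hK0 hKL' (by linarith) (by linarith) hε hε1 hπ hD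
    (F := Finset.univ) (Δ := fun _ => min δ 1) (fun _ _ a _ => Finset.mem_univ a)
    (fun _ _ => ⟨hδ', min_le_right _ _⟩) fun t ht a ha b hb =>
      (min_le_left _ _).trans (le_sub_of_ofReal_le_gap ht (hD t ht) ha hb (hgap a))
  rw [sub_sub_cancel, Finset.sum_const, Finset.card_univ, Fintype.card_fin, nsmul_eq_mul,
    ← hΥdef] at hmain
  rw [hS] at hitem
  linarith [mul_le_mul_of_nonneg_left hitem L.cast_nonneg]

end SqrtBound

end CascadeBandit

theorem theorem1 {L K : ℕ} (hKL : K ≤ L) (ε : ℝ) (hε : 1 / 2 < ε) (hε1 : ε < 1) :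
    (∀ (γ : ℝ), 1 / 2 < γ → γ < 1 →
      ∀ (Ω : Type u) [MeasurableSpace Ω] (μ : Measure Ω) [IsProbabilityMeasure μ]
        (n : ℕ) (α : ℕ → Fin L → ℝ) (A : ℕ → Ω → Fin L → Bool) (D : ℕ → Finset (Fin L))
        (π : CascadeBandit.History L K → CascadeBandit.RankedList L K),
        CascadeBandit.IsEnvironment μ n α A →
        (∀ t ∈ Finset.Icc 1 n, CascadeBandit.IsTopK K (α t) (D t)) →
        CascadeBandit.IsCascadeDUCB γ ε π →
        ENNReal.ofReal (CascadeBandit.regret μ α A π n) ≤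
          ENNReal.ofReal (L * CascadeBandit.numBreaks α n *
            (Real.log ((1 - γ) * ε) / Real.log γ)) +
          ∑ a : Fin L, CascadeBandit.constC ε γ (CascadeBandit.gap α D n a) *
            ((⌈(n : ℝ) * (1 - γ)⌉₊ : ℕ) : ℝ≥0∞) * ENNReal.ofReal (Real.log (1 / (1 - γ)))) ∧
    (∀ δ : ℝ, 0 < δ → ∃ c : ℝ,
      ∀ (Ω : Type u) [MeasurableSpace Ω] (μ : Measure Ω) [IsProbabilityMeasure μ]
        (n : ℕ) (α : ℕ → Fin L → ℝ) (A : ℕ → Ω → Fin L → Bool) (D : ℕ → Finset (Fin L))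
        (π : CascadeBandit.History L K → CascadeBandit.RankedList L K),
        CascadeBandit.IsEnvironment μ n α A →
        (∀ t ∈ Finset.Icc 1 n, CascadeBandit.IsTopK K (α t) (D t)) →
        (∀ a : Fin L, ENNReal.ofReal δ ≤ CascadeBandit.gap α D n a) →
        1 ≤ CascadeBandit.numBreaks α n →
        CascadeBandit.IsCascadeDUCB
          (1 - 1 / 4 * √((CascadeBandit.numBreaks α n : ℝ) / n)) ε π →
        CascadeBandit.regret μ α A π n ≤
          c * √((n : ℝ) * CascadeBandit.numBreaks α n) * Real.log n) := by
  refine ⟨?_, ?_⟩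
  · intro γ hγ hγ1 Ω _ μ _ n α A D π hA hD hπ
    exact hA.ofReal_regret_le hKL hγ hγ1 hε hε1 hπ hD
  · intro δ hδ
    refine ⟨16 * L + 192 * L * (Real.exp 2 / min δ 1), ?_⟩
    intro Ω _ μ _ n α A D π hA hD hgap hΥ hπ
    exact hA.regret_le_sqrt hKL hε hε1 hδ hD hgap hΥ hπ
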